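/- Let $d\ge 1$, let $v_1,\dots,v_d$ be a basis of $\mathbb{R}^d$, $\Lambda=\mathbb{Z}v_1+\dots+\mathbb{Z}v_d$, $\Omega_\Lambda=\{\sum_j a_jv_j:\ a_j\in[0,1)\}$, let $|\Lambda|$ be the volume of $\Omega_\Lambda$, $\mu$ the normalized Lebesgue measure on $\Omega_\Lambda$, and $\Lambda^*=\{w\in\mathbb{R}^d:\langle w,v\rangle\in\mathbb{Z}\text{ for all }v\in\Lambda\}$. Let $B(x,R)$ be the closed Euclidean ball and write $\mathrm{vol}(R)=\mathrm{Vol}(B(0,R))/|\Lambda|$. For $\alpha>d/2$ let $W^{\alpha,2}(\Omega_\Lambda)$ be the space of continuous $\Lambda$-periodic functions $f:\mathbb{R}^d\to\mathbb{R}$ with $$\|f\|_{W^{\alpha,2}}=\Big(\sum_{w\in\Lambda^*}(1+4\pi^2|w|^2)^{\alpha}|\hat f(w)|^2\Big)^{1/2}<\infty,\qquad \hat f(w)=\int_{\Omega_\Lambda}f(u)e^{-2\pi i\langle u,w\rangle}\,d\mu(u).$$ Let $A\subseteq\mathbb{N}$ be infinite and, for $N\in A$, let $X_N=(x_1^{(N)},\dots,x_N^{(N)})$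 be $N$ points of $\Omega_\Lambda$ (repetitions allowed). $(X_N)_{N\in A}$ is a sequence of QMC designs for $W^{\alpha,2}(\Omega_\Lambda)$ if there is $c>0$ such that for all $N\in A$, $N\ge1$, and all $f\in W^{\alpha,2}(\Omega_\Lambda)$ $$\Big|\frac1N\sum_{j=1}^N f(x_j^{(N)})-\int_{\Omega_\Lambda}f\,d\mu\Big|\le c\,N^{-\alpha/d}\|f\|_{W^{\alpha,2}}.$$ The number variance of $X_N$ for balls of radius $R$ is $$V(X_N,R)=\int_{\Omega_\Lambda}\Big(\sum_{j=1}^N\#\{v\in\Lambda:\ x_j^{(N)}+v\in B(x,R)\}-N\,\mathrm{vol}(R)\Big)^2d\mu(x).$$ Theorem. Let $\alpha>\frac{d+1}{2}$ and let $(X_N)_{N\in A}$ be a sequence of QMC designs for $W^{\alpha,2}(\Omega_\Lambda)$. Then, with $N\to\infty$ through $A$, $(X_N)_{N\in A}$ is 1. hyperuniform for large balls: $V(X_N,R)=o(N)$ for every $R\in(0,\tfrac12\operatorname{diam}\Omega_\Lambda)$; 2. hyperuniform for small balls: $V(X_N,R_N)=o(N\,\mathrm{vol}(R_N))$ for every sequence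 of radii $R_N>0$ with $R_N\to0$ and $N\,\mathrm{vol}(R_N)\to\infty$; 3. hyperuniform for balls of threshold order: $\limsup_{N\to\infty}V(X_N,tN^{-1/d})=O(t^{d-1})$ as $t\to\infty$. -/

import Mathlib

open MeasureTheory Filter Topology Asymptotics

noncomputable section

namespace FlatTorus

/-- Euclidean space of dimension `d`. -/
abbrev E (d : ℕ) : Type := EuclideanSpace ℝ (Fin d)

variable {d : ℕ}

/-- The lattice of all integer combinations of the basis vectors `b 0, …, b (d - 1)`
(the columns of a nonsingular matrix). -/
def lattice (b : Module.Basis (Fin d) ℝ (E d)) : Submodule ℤ (E d) :=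
  Submodule.span ℤ (Set.range b)

/-- The half-open fundamental parallelepiped: the vectors all of whose coordinates with respect
to `b` lie in `[0, 1)`. -/
def cell (b : Module.Basis (Fin d) ℝ (E d)) : Set (E d) :=
  ZSpan.fundamentalDomain b

/-- The dual lattice: the vectors having integer inner product with every lattice vector. -/
def dualLattice (b : Module.Basis (Fin d) ℝ (E d)) : Set (E d) :=
  {w | ∀ v ∈ lattice b, ∃ n : ℤ, inner ℝ w v = (n : ℝ)}

/-- Normalized Lebesgue measure on the fundamental parallelepiped. -/
def mu (b : Module.Basis (Fin d) ℝ (E d)) : Measure (E d) :=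
  (volume (cell b))⁻¹ • volume.restrict (cell b)

/-- The volume of a Euclidean ball of radius `R`, normalized so that the fundamental
parallelepiped has volume one. -/
def ballVol (b : Module.Basis (Fin d) ℝ (E d)) (R : ℝ) : ℝ :=
  volume.real (Metric.closedBall (0 : E d) R) / volume.real (cell b)

/-- The number of points of the periodic configuration `{x j + v : v ∈ Λ}` that lie in the
Euclidean ball `B(x, R)`. The inner sum has only finitely many nonzero terms, and at most one if
`2 R` is less than the length of every nonzero lattice vector. -/
def ballCount (b : Module.Basis (Fin d) ℝ (E d)) {N : ℕ} (X : Fin N → E d) (x : E d) (R : ℝ) : ℝ :=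
  ∑ j, ∑' v : lattice b, (Metric.closedBall x R).indicator (fun _ => (1 : ℝ)) (X j + (v : E d))

/-- The number variance of an `N`-point configuration for balls of radius `R`. -/
def numberVariance (b : Module.Basis (Fin d) ℝ (E d)) {N : ℕ} (X : Fin N → E d) (R : ℝ) : ℝ :=
  ∫ x, (ballCount b X x R - (N : ℝ) * ballVol b R) ^ 2 ∂(mu b)

/-- The filter `N → ∞`, where `N` runs through the index set `A`. -/
def toInfty (A : Set ℕ) : Filter ℕ := atTop ⊓ 𝓟 A

/-- Hyperuniformity for large balls. -/
def HyperuniformLarge (b : Module.Basis (Fin d) ℝ (E d)) (A : Set ℕ)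
    (X : (N : ℕ) → Fin N → E d) : Prop :=
  ∀ R : ℝ, 0 < R → R < Metric.diam (cell b) / 2 →
    (fun N => numberVariance b (X N) R) =o[toInfty A] fun N : ℕ => (N : ℝ)

/-- Hyperuniformity for small balls. -/
def HyperuniformSmall (b : Module.Basis (Fin d) ℝ (E d)) (A : Set ℕ)
    (X : (N : ℕ) → Fin N → E d) : Prop :=
  ∀ R : ℕ → ℝ, (∀ N ∈ A, 0 < R N) → Tendsto R (toInfty A) (𝓝 0) →
    Tendsto (fun N : ℕ => (N : ℝ) * ballVol b (R N)) (toInfty A) atTop →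
    (fun N => numberVariance b (X N) (R N)) =o[toInfty A] fun N : ℕ => (N : ℝ) * ballVol b (R N)

/-- Hyperuniformity for balls of threshold order. The upper limit is taken in the extended
reals. -/
def HyperuniformThreshold (b : Module.Basis (Fin d) ℝ (E d)) (A : Set ℕ)
    (X : (N : ℕ) → Fin N → E d) : Prop :=
  ∃ C : ℝ, ∀ᶠ t : ℝ in atTop,
    limsup (fun N : ℕ =>
      ((numberVariance b (X N) (t * (N : ℝ) ^ (-(1 / (d : ℝ)))) : ℝ) : EReal)) (toInfty A)
      ≤ ((C * t ^ ((d : ℝ) - 1) : ℝ) : EReal)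

/-- Fourier coefficient of a function on the flat torus. -/
def fourierCoef (b : Module.Basis (Fin d) ℝ (E d)) (f : E d → ℝ) (w : E d) : ℂ :=
  ∫ u, (f u : ℂ) * Complex.exp (-(2 * Real.pi * Complex.I * ((inner ℝ u w : ℝ) : ℂ))) ∂(mu b)

/-- The terms of the square of the Sobolev norm of order `α`. -/
def sobolevTerm (b : Module.Basis (Fin d) ℝ (E d)) (α : ℝ) (f : E d → ℝ) (w : E d) : ℝ :=
  (1 + 4 * Real.pi ^ 2 * ‖w‖ ^ 2) ^ α * ‖fourierCoef b f w‖ ^ 2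

/-- The Sobolev space of order `α > d / 2` on the flat torus: the continuous lattice-periodic
real-valued functions with finite Sobolev norm. (For `α > d / 2` each class of functions with
finite norm has exactly one continuous representative.) -/
def MemSobolev (b : Module.Basis (Fin d) ℝ (E d)) (α : ℝ) (f : E d → ℝ) : Prop :=
  Continuous f ∧ (∀ x : E d, ∀ v ∈ lattice b, f (x + v) = f x) ∧
    Summable fun w : dualLattice b => sobolevTerm b α f w

/-- The Sobolev norm. -/
def sobolevNorm (b : Module.Basis (Fin d) ℝ (E d)) (α : ℝ) (f : E d → ℝ) : ℝ :=
  Real.sqrt (∑' w : dualLattice b, sobolevTerm b α f w)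

/-- The equal-weight cubature rule with nodes `X`. -/
def cubature {N : ℕ} (X : Fin N → E d) (f : E d → ℝ) : ℝ :=
  (1 / (N : ℝ)) * ∑ j, f (X j)

/-- QMC designs for the Sobolev space of order `α`: the worst-case error of the cubature rules is
at most a constant times `N ^ (-α / d)`. -/
def IsQMCDesign (b : Module.Basis (Fin d) ℝ (E d)) (A : Set ℕ)
    (X : (N : ℕ) → Fin N → E d) (α : ℝ) : Prop :=
  ∃ c : ℝ, 0 < c ∧ ∀ N ∈ A, 1 ≤ N → ∀ f : E d → ℝ, MemSobolev b α f →
    |cubature (X N) f - ∫ x, f x ∂(mu b)| ≤ c * (N : ℝ) ^ (-(α / (d : ℝ))) * sobolevNorm b α f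

end FlatTorus

end

/-!
The theorem rests on one estimate, uniform in the radius (`exists_numberVariance_le`):
`V(X_N, R) ≤ C (R N ^ (1 / d)) ^ (d - 1)`. The right-hand side is `O(N ^ (1 - 1 / d))` for fixed
`R`, it is `N vol(R)` times `O(1 / (R N ^ (1 / d)))` for varying `R`, and it equals `C t ^ (d - 1)`
for `R = t N ^ (-1 / d)`; these are the three kinds of hyperuniformity.

Identify the dual lattice with `ℤ ^ d`, and write `w_n` for the dual vector and `S(n)` for the
exponential sum `∑ j, exp (2 π i ⟪w_n, x_j⟫)` at the index `n`. Parseval's identity and unfolding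
(`hasSum_numberVariance`) express the number variance as the sum over `n ≠ 0` of `|S(n)|²` times the
squared Fourier transform of a ball at `w_n`, which is `O(R ^ (d - 1) |n| ^ (-(d + 1)))`
(`exists_ballTransform_bound`). The latter decay is that of a Bessel function; it follows from the
differential equation of the cosine transform of `(1 - s²) ^ ((d - 1) / 2)` by an energy estimate
(`exists_bound_of_bessel_ode`). So it suffices to show
`∑ n ≠ 0, |n| ^ (-(d + 1)) |S(n)|² = O(N ^ (1 - 1 / d))`.

Testing the QMC property on the extremal trigonometric polynomials gives (`sum_expSum_le`)
`∑ n ≠ 0, |n| ^ (-2 α) |S(n)|² = O(N ^ (2 - 2 α / d))`. For `|n| = O(m)`, where `m ~ N ^ (1 / d)`,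
this implies what is needed by comparing the weights. As `2 α > d + 1`, it says too little about
the high frequencies. There one uses positive definiteness: for a finite set `Q` of frequencies,
`∑ p q ∈ Q, |S(p - q + a)|²` is maximal at `a = 0` (`sum_norm_sq_expSum_shift_le`). Hence the sum
of `|S|²` over any box of side `m` is at most a constant times the sum over the frequencies of size
`O(m)` (`sum_box_norm_sq_expSum_le`), which is `O(N²)`. Summing over a tiling by such boxes with
weights `|n| ^ (-(d + 1))`, which are summable over `ℤ ^ d`, gives
`O(m ^ (-(d + 1)) N²) = O(N ^ (1 - 1 / d))` (`exists_sum_norm_pow_inv_le`).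
-/

noncomputable section

namespace FlatTorus

/-! ### Decay of the cosine transform of a power of `1 - s²` -/

lemma hasDerivAt_integral_mul_cos {g : ℝ → ℝ} (hg : Continuous g) (l : ℝ) :
    HasDerivAt (fun l => ∫ s in (-1 : ℝ)..1, g s * Real.cos (l * s))
      (∫ s in (-1 : ℝ)..1, -(g s * s) * Real.sin (l * s)) l := by
  refine (intervalIntegral.hasDerivAt_integral_of_dominated_loc_of_deriv_le (s := Set.univ)
    (F' := fun l s => -(g s * s) * Real.sin (l * s)) (bound := fun s => |g s * s|)
    univ_mem (Eventually.of_forall fun x => ?_) ?_ ?_ ?_ ?_ ?_).2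
  · exact Continuous.aestronglyMeasurable (by fun_prop)
  · exact Continuous.intervalIntegrable (by fun_prop) _ _
  · exact Continuous.aestronglyMeasurable (by fun_prop)
  · refine ae_of_all _ fun s _ x _ => ?_
    rw [Real.norm_eq_abs, abs_mul, abs_neg]
    exact mul_le_of_le_one_right (abs_nonneg _) (Real.abs_sin_le_one _)
  · exact Continuous.intervalIntegrable (by fun_prop) _ _
  · refine ae_of_all _ fun s _ x _ => ?_
    have h := (((hasDerivAt_id x).mul_const s).cos).const_mul (g s)
    refine h.congr_deriv ?_
    simp only [id]
    ring

lemma hasDerivAt_integral_mul_sin {g : ℝ → ℝ} (hg : Continuous g) (l : ℝ) :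
    HasDerivAt (fun l => ∫ s in (-1 : ℝ)..1, g s * Real.sin (l * s))
      (∫ s in (-1 : ℝ)..1, (g s * s) * Real.cos (l * s)) l := by
  refine (intervalIntegral.hasDerivAt_integral_of_dominated_loc_of_deriv_le (s := Set.univ)
    (F' := fun l s => (g s * s) * Real.cos (l * s)) (bound := fun s => |g s * s|)
    univ_mem (Eventually.of_forall fun x => ?_) ?_ ?_ ?_ ?_ ?_).2
  · exact Continuous.aestronglyMeasurable (by fun_prop)
  · exact Continuous.intervalIntegrable (by fun_prop) _ _
  · exact Continuous.aestronglyMeasurable (by fun_prop)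
  · refine ae_of_all _ fun s _ x _ => ?_
    rw [Real.norm_eq_abs, abs_mul]
    exact mul_le_of_le_one_right (abs_nonneg _) (Real.abs_cos_le_one _)
  · exact Continuous.intervalIntegrable (by fun_prop) _ _
  · refine ae_of_all _ fun s _ x _ => ?_
    have h := (((hasDerivAt_id x).mul_const s).sin).const_mul (g s)
    refine h.congr_deriv ?_
    simp only [id]
    ring

/-- Every solution of the Bessel-type equation `l I'' + (k + 2) I' + l I = 0` is
`O(l ^ (-(k + 2) / 2))`. The energy
`l ^ (k + 2) (I² + I'²) + (k + 2) l ^ (k + 1) I I'` has derivative `-(k + 2) l ^ k I I'`, which for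
`l ≥ k + 2` is at most `(k + 2) / l²` times the energy, so the energy stays bounded. -/
lemma exists_bound_of_bessel_ode (k : ℕ) {I I' I'' : ℝ → ℝ}
    (h1 : ∀ l, HasDerivAt I (I' l) l) (h2 : ∀ l, HasDerivAt I' (I'' l) l)
    (ode : ∀ l, l * I'' l + (k + 2) * I' l + l * I l = 0) :
    ∃ C : ℝ, ∀ l : ℝ, (k + 2 : ℝ) ≤ l → l ^ (k + 2) * I l ^ 2 ≤ C := by
  set Φ : ℝ → ℝ := fun l =>
    l ^ (k + 2) * (I l ^ 2 + I' l ^ 2) + (k + 2) * l ^ (k + 1) * (I l * I' l) with hΦ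
  have hΦd : ∀ l, HasDerivAt Φ (-(k + 2) * l ^ k * (I l * I' l)) l := by
    intro l
    have := (((hasDerivAt_id l).pow (k + 2)).mul (((h1 l).pow 2).add ((h2 l).pow 2))).add
      ((((hasDerivAt_id l).pow (k + 1)).const_mul (k + 2 : ℝ)).mul ((h1 l).mul (h2 l)))
    refine this.congr_deriv ?_
    have e := ode l
    simp only [id, Pi.add_apply, Pi.mul_apply, Pi.pow_apply]
    push_cast
    linear_combination (l ^ k * (2 * l * I' l + (k + 2) * I l)) * e
  have hlow : ∀ l : ℝ, (k + 2 : ℝ) ≤ l →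
      l ^ (k + 2) * (I l ^ 2 + I' l ^ 2) / 2 ≤ Φ l := by
    intro l hl
    have hl0 : 0 < l := lt_of_lt_of_le (by positivity) hl
    have hp : 0 < l ^ (k + 1) := by positivity
    have : Φ l - l ^ (k + 2) * (I l ^ 2 + I' l ^ 2) / 2
        = l ^ (k + 1) * ((l - (k + 2)) * (I l ^ 2 + I' l ^ 2) / 2
          + (k + 2) * (I l + I' l) ^ 2 / 2) := by
      simp only [hΦ]; ring
    have h3 : 0 ≤ (l - (k + 2)) * (I l ^ 2 + I' l ^ 2) :=
      mul_nonneg (by linarith) (by positivity)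
    have h4 : (0 : ℝ) ≤ (k + 2) * (I l + I' l) ^ 2 := by positivity
    have := mul_nonneg hp.le (add_nonneg (div_nonneg h3 zero_le_two) (div_nonneg h4 zero_le_two))
    linarith
  set Ψ : ℝ → ℝ := fun l => Φ l * Real.exp ((k + 2) / l) with hΨ
  have hΨd : ∀ l : ℝ, (k + 2 : ℝ) ≤ l → HasDerivAt Ψ
      ((-(k + 2) * l ^ k * (I l * I' l) - (k + 2) / l ^ 2 * Φ l) * Real.exp ((k + 2) / l)) l := by
    intro l hl
    have hl0 : 0 < l := lt_of_lt_of_le (by positivity) hl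
    have he : HasDerivAt (fun l : ℝ => (k + 2 : ℝ) / l) (-(k + 2) / l ^ 2) l :=
      ((hasDerivAt_const l (k + 2 : ℝ)).div (hasDerivAt_id l) hl0.ne').congr_deriv (by simp)
    refine ((hΦd l).mul he.exp).congr_deriv ?_
    ring
  -- the factor `exp ((k + 2) / l)` compensates the growth rate `(k + 2) / l²` of the energy
  have hanti : AntitoneOn Ψ (Set.Ici (k + 2 : ℝ)) := by
    refine antitoneOn_of_deriv_nonpos (convex_Ici _)
      (fun l hl => (hΨd l hl).continuousAt.continuousWithinAt)
      (fun l hl => ?_) (fun l hl => ?_)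
    · rw [interior_Ici] at hl
      exact (hΨd l hl.le).differentiableAt.differentiableWithinAt
    · rw [interior_Ici] at hl
      have hl' : (k + 2 : ℝ) ≤ l := hl.le
      have hl0 : 0 < l := lt_of_lt_of_le (by positivity) hl'
      rw [(hΨd l hl').deriv]
      refine mul_nonpos_of_nonpos_of_nonneg ?_ (Real.exp_pos _).le
      have h5 := mul_le_mul_of_nonneg_left (hlow l hl')
        (show (0 : ℝ) ≤ (k + 2) / l ^ 2 by positivity)
      have h6 : (k + 2 : ℝ) / l ^ 2 * (l ^ (k + 2) * (I l ^ 2 + I' l ^ 2) / 2)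
          = (k + 2) * l ^ k * (I l ^ 2 + I' l ^ 2) / 2 := by
        rw [pow_add]; field_simp
      have h7 : (0 : ℝ) ≤ (k + 2) * l ^ k * (I l + I' l) ^ 2 := by positivity
      nlinarith
  refine ⟨2 * Ψ (k + 2), fun l hl => ?_⟩
  have hl0 : 0 < l := lt_of_lt_of_le (by positivity) hl
  have h8 := hanti (Set.mem_Ici.2 le_rfl) hl hl
  have h9 := hlow l hl
  have h10 : Φ l ≤ Ψ l := by
    have h0 : 0 ≤ Φ l := le_trans (by positivity) h9
    exact le_mul_of_one_le_right h0 (Real.one_le_exp (by positivity))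
  have h11 : 0 ≤ l ^ (k + 2) * I' l ^ 2 := by positivity
  linarith

/-- The cosine transform of `(1 - s²) ^ (k / 2)` on `[-1, 1]`, a multiple of
`l ^ (-(k + 1) / 2) J_{(k + 1) / 2}(l)`. -/
def cosTransform (k : ℕ) (l : ℝ) : ℝ :=
  ∫ s in (-1 : ℝ)..1, Real.sqrt (1 - s ^ 2) ^ k * Real.cos (l * s)

/-- Integration by parts: `(1 - s²) ^ (k / 2 + 1)` vanishes at the endpoints and has derivative
`-(k + 2) s (1 - s²) ^ (k / 2)`. -/
lemma integral_sqrt_pow_by_parts (k : ℕ) (l : ℝ) :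
    ∫ s in (-1 : ℝ)..1, (l * (Real.sqrt (1 - s ^ 2) ^ (k + 2) * Real.cos (l * s))
      - (k + 2) * (Real.sqrt (1 - s ^ 2) ^ k * s * Real.sin (l * s))) = 0 := by
  have h := intervalIntegral.integral_eq_sub_of_hasDerivAt_of_le (a := -1) (b := 1)
    (f := fun s => Real.sqrt (1 - s ^ 2) ^ (k + 2) * Real.sin (l * s))
    (f' := fun s => l * (Real.sqrt (1 - s ^ 2) ^ (k + 2) * Real.cos (l * s))
      - (k + 2) * (Real.sqrt (1 - s ^ 2) ^ k * s * Real.sin (l * s))) (by norm_num)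
    (Continuous.continuousOn (by fun_prop)) ?_
    (Continuous.intervalIntegrable (by fun_prop) _ _)
  · rw [h]; simp
  · intro s hs
    have hpos : 0 < 1 - s ^ 2 := by nlinarith [hs.1, hs.2]
    have hsq : Real.sqrt (1 - s ^ 2) ≠ 0 := (Real.sqrt_pos.2 hpos).ne'
    have hd : HasDerivAt (fun s : ℝ => 1 - s ^ 2) (-(2 * s)) s := by
      simpa using ((hasDerivAt_id s).pow 2).const_sub 1
    have := ((hd.sqrt hpos.ne').pow (k + 2)).mul (((hasDerivAt_id s).const_mul l).sin)
    refine this.congr_deriv ?_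
    simp only [id, Pi.pow_apply]
    have e1 : Real.sqrt (1 - s ^ 2) ^ (k + 2 - 1)
        = Real.sqrt (1 - s ^ 2) ^ k * Real.sqrt (1 - s ^ 2) := by rw [← pow_succ]; congr 1
    rw [e1]
    push_cast
    field_simp
    ring

/-- The cosine transform is `O(l ^ (-(k + 2) / 2))`, uniformly in `l > 0`: large `l` by the
differential equation, small `l` by the trivial bound. -/
lemma exists_cosTransform_bound (k : ℕ) :
    ∃ C : ℝ, 0 ≤ C ∧ ∀ l : ℝ, 0 < l → l ^ (k + 2) * cosTransform k l ^ 2 ≤ C := by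
  have hc : Continuous fun s : ℝ => Real.sqrt (1 - s ^ 2) ^ k := by fun_prop
  obtain ⟨C, hC⟩ := exists_bound_of_bessel_ode k (I := cosTransform k)
    (fun l => hasDerivAt_integral_mul_cos hc l)
    (fun l => hasDerivAt_integral_mul_sin (g := fun s => -(Real.sqrt (1 - s ^ 2) ^ k * s))
      (by fun_prop) l) (by
      intro l
      rw [← integral_sqrt_pow_by_parts k l, cosTransform, ← intervalIntegral.integral_const_mul,
        ← intervalIntegral.integral_const_mul, ← intervalIntegral.integral_const_mul,
        ← intervalIntegral.integral_add, ← intervalIntegral.integral_add]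
      · refine intervalIntegral.integral_congr fun s hs => ?_
        rw [Set.uIcc_of_le (by norm_num)] at hs
        have : 0 ≤ 1 - s ^ 2 := by nlinarith [hs.1, hs.2]
        have e := Real.sq_sqrt this
        simp only [pow_add (Real.sqrt (1 - s ^ 2)) k 2, e]
        ring
      all_goals exact Continuous.intervalIntegrable (by fun_prop) _ _)
  refine ⟨max C ((k + 2 : ℝ) ^ (k + 2) * 2 ^ 2), le_max_of_le_right (by positivity),
    fun l hl => ?_⟩
  rcases le_total (k + 2 : ℝ) l with h | h
  · exact (hC l h).trans (le_max_left _ _)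
  · refine le_trans ?_ (le_max_right _ _)
    have hb : |cosTransform k l| ≤ 2 := by
      have := intervalIntegral.norm_integral_le_of_norm_le_const (a := -1) (b := 1) (C := 1)
        (f := fun s => Real.sqrt (1 - s ^ 2) ^ k * Real.cos (l * s)) (by
          intro s _
          rw [Real.norm_eq_abs, abs_mul, abs_pow, abs_of_nonneg (Real.sqrt_nonneg _)]
          refine mul_le_one₀ (pow_le_one₀ (Real.sqrt_nonneg _) ?_) (abs_nonneg _)
            (Real.abs_cos_le_one _)
          rw [Real.sqrt_le_one]
          nlinarith [sq_nonneg s])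
      rw [Real.norm_eq_abs] at this
      refine this.trans ?_
      norm_num
    have := sq_le_sq' (abs_le.1 hb).1 (abs_le.1 hb).2
    gcongr

/-! ### The Fourier transform of a ball -/

/-- The splitting of `ℝ ^ (k + 1)` into the first coordinate and the remaining ones. -/
def splitFirst (k : ℕ) : E (k + 1) ≃ᵐ ℝ × E k :=
  ((MeasurableEquiv.toLp 2 (Fin (k + 1) → ℝ)).symm.trans
    (MeasurableEquiv.piFinSuccAbove (fun _ : Fin (k + 1) => ℝ) 0)).trans
    ((MeasurableEquiv.refl ℝ).prodCongr (MeasurableEquiv.toLp 2 (Fin k → ℝ)))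

lemma splitFirst_fst (k : ℕ) (x : E (k + 1)) : (splitFirst k x).1 = x 0 := rfl

lemma splitFirst_snd (k : ℕ) (x : E (k + 1)) (i : Fin k) : (splitFirst k x).2 i = x i.succ := rfl

lemma norm_sq_eq_splitFirst (k : ℕ) (x : E (k + 1)) :
    ‖x‖ ^ 2 = (splitFirst k x).1 ^ 2 + ‖(splitFirst k x).2‖ ^ 2 := by
  simp only [EuclideanSpace.norm_sq_eq, Fin.sum_univ_succ, splitFirst_fst, splitFirst_snd,
    Real.norm_eq_abs, sq_abs]

lemma measurePreserving_splitFirst (k : ℕ) :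
    MeasurePreserving (splitFirst k) volume volume :=
  (((MeasurePreserving.id volume).prod (PiLp.volume_preserving_toLp (Fin k))).comp
    ((volume_preserving_piFinSuccAbove (fun _ : Fin (k + 1) => ℝ) 0).comp
      (PiLp.volume_preserving_ofLp (Fin (k + 1)))))

/-- Integration over the unit ball of a function of the first coordinate, by slicing. -/
lemma setIntegral_closedBall_comp_fst (k : ℕ) {φ : ℝ → ℝ} (hφ : Continuous φ) :
    ∫ x in Metric.closedBall (0 : E (k + 1)) 1, φ (x 0)
      = volume.real (Metric.closedBall (0 : E k) 1)
        * ∫ s in (-1 : ℝ)..1, Real.sqrt (1 - s ^ 2) ^ k * φ s := by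
  set S : Set (ℝ × E k) := {p | p.1 ^ 2 + ‖p.2‖ ^ 2 ≤ 1} with hS
  have hSm : MeasurableSet S := measurableSet_le (by fun_prop) (by fun_prop)
  have hball : Metric.closedBall (0 : E (k + 1)) 1 = splitFirst k ⁻¹' S := by
    ext x
    rw [mem_closedBall_zero_iff, Set.mem_preimage, hS, Set.mem_ofPred_eq, ← norm_sq_eq_splitFirst,
      sq_le_one_iff₀ (norm_nonneg _)]
  have hSfin : volume S ≠ ⊤ := by
    rw [← (measurePreserving_splitFirst k).measure_preimage hSm.nullMeasurableSet, ← hball]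
    exact measure_closedBall_lt_top.ne
  have h1 : ∫ x in Metric.closedBall (0 : E (k + 1)) 1, φ (x 0) = ∫ p in S, φ p.1 := by
    rw [hball]
    exact (measurePreserving_splitFirst k).setIntegral_preimage_emb
      (splitFirst k).measurableEmbedding (fun p => φ p.1) S
  have habs : ∀ s : ℝ, ∀ y : E k, (s, y) ∈ S → s ∈ Set.Icc (-1 : ℝ) 1 := by
    intro s y h
    have h' : s ^ 2 + ‖y‖ ^ 2 ≤ 1 := h
    exact abs_le.1 ((sq_le_one_iff_abs_le_one s).1 (by nlinarith [sq_nonneg ‖y‖]))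
  have hint : IntegrableOn (fun p : ℝ × E k => φ p.1) S := by
    obtain ⟨M, hM⟩ := (isCompact_Icc (a := (-1 : ℝ)) (b := 1)).exists_bound_of_continuousOn
      hφ.continuousOn
    exact IntegrableOn.of_bound hSfin.lt_top (Continuous.aestronglyMeasurable (by fun_prop)) M
      ((ae_restrict_iff' hSm).2 (ae_of_all _ fun p hp => hM _ (habs p.1 p.2 hp)))
  rw [h1, ← integral_indicator hSm, Measure.volume_eq_prod,
    integral_prod _ (by rw [← Measure.volume_eq_prod]; exact hint.integrable_indicator hSm),
    intervalIntegral.integral_of_le (by norm_num), ← integral_Icc_eq_integral_Ioc,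
    ← integral_const_mul, ← integral_indicator measurableSet_Icc]
  refine integral_congr_ae (ae_of_all _ fun s => ?_)
  by_cases hs : s ∈ Set.Icc (-1 : ℝ) 1
  · have hpos : 0 ≤ 1 - s ^ 2 := by nlinarith [hs.1, hs.2]
    rw [Set.indicator_of_mem hs]
    have : (fun y : E k => S.indicator (fun p => φ p.1) (s, y))
        = (Metric.closedBall (0 : E k) (Real.sqrt (1 - s ^ 2))).indicator fun _ => φ s := by
      funext y
      have : (s, y) ∈ S ↔ y ∈ Metric.closedBall (0 : E k) (Real.sqrt (1 - s ^ 2)) := by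
        rw [mem_closedBall_zero_iff, Real.le_sqrt (norm_nonneg _) hpos]
        simp only [hS, Set.mem_ofPred_eq]
        constructor <;> intro h <;> linarith
      by_cases hy : (s, y) ∈ S
      · rw [Set.indicator_of_mem hy, Set.indicator_of_mem (this.1 hy)]
      · rw [Set.indicator_of_notMem hy, Set.indicator_of_notMem (fun h => hy (this.2 h))]
    simp only [this]
    rw [integral_indicator measurableSet_closedBall, setIntegral_const, smul_eq_mul,
      Measure.real, Measure.addHaar_closedBall' _ _ (Real.sqrt_nonneg _), ENNReal.toReal_mul,
      ENNReal.toReal_ofReal (by positivity), finrank_euclideanSpace, Fintype.card_fin,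
      Measure.real]
    ring
  · rw [Set.indicator_of_notMem hs]
    have : (fun y : E k => S.indicator (fun p => φ p.1) (s, y)) = fun _ => 0 := by
      funext y
      exact Set.indicator_of_notMem (fun h => hs (habs s y h)) _
    simp only [this, integral_zero]

/-- The Fourier transform of the indicator function of the ball of radius `R` around the origin. -/
def ballTransform (d : ℕ) (R : ℝ) (w : E d) : ℂ :=
  ∫ x in Metric.closedBall (0 : E d) R,
    Complex.exp (-(2 * Real.pi * Complex.I * ((inner ℝ x w : ℝ) : ℂ)))

lemma ballTransform_eq_integral_cos (d : ℕ) (R : ℝ) (w : E d) :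
    ballTransform d R w
      = ((∫ x in Metric.closedBall (0 : E d) R, Real.cos (2 * Real.pi * inner ℝ x w) : ℝ) : ℂ) := by
  have hB : IsCompact (Metric.closedBall (0 : E d) R) := isCompact_closedBall _ _
  have hsin : ∫ x in Metric.closedBall (0 : E d) R, Real.sin (2 * Real.pi * inner ℝ x w) = 0 := by
    have h : ∫ x in Metric.closedBall (0 : E d) R, Real.sin (2 * Real.pi * inner ℝ x w)
        = -∫ x in Metric.closedBall (0 : E d) R, Real.sin (2 * Real.pi * inner ℝ x w) := by
      conv_lhs => rw [← integral_indicator measurableSet_closedBall, ← integral_neg_eq_self]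
      rw [← integral_neg, ← integral_indicator measurableSet_closedBall]
      refine integral_congr_ae (ae_of_all _ fun x => ?_)
      simp only [Set.indicator, mem_closedBall_zero_iff, norm_neg, inner_neg_left, mul_neg,
        Real.sin_neg]
    linarith
  have hexp : ∀ x : E d, Complex.exp (-(2 * Real.pi * Complex.I * ((inner ℝ x w : ℝ) : ℂ)))
      = (Real.cos (2 * Real.pi * inner ℝ x w) : ℂ)
        - (Real.sin (2 * Real.pi * inner ℝ x w) : ℂ) * Complex.I := by
    intro x
    have : -(2 * Real.pi * Complex.I * ((inner ℝ x w : ℝ) : ℂ))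
        = ((-(2 * Real.pi * inner ℝ x w) : ℝ) : ℂ) * Complex.I := by push_cast; ring
    rw [this, Complex.exp_mul_I, ← Complex.ofReal_cos, ← Complex.ofReal_sin, Real.cos_neg,
      Real.sin_neg]
    push_cast; ring
  simp only [ballTransform, hexp]
  rw [integral_sub, integral_mul_const, integral_complex_ofReal, integral_complex_ofReal, hsin]
  · simp
  · exact (Continuous.continuousOn (by fun_prop)).integrableOn_compact hB
  · exact (Continuous.continuousOn (by fun_prop)).integrableOn_compact hB

/-- By rotation invariance, the Fourier transform of the unit ball reduces to the cosine transform
of the slice volumes. -/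
lemma setIntegral_closedBall_cos_inner (k : ℕ) (l : ℝ) (e : E (k + 1)) (he : ‖e‖ = 1) :
    ∫ x in Metric.closedBall (0 : E (k + 1)) 1, Real.cos (l * inner ℝ x e)
      = volume.real (Metric.closedBall (0 : E k) 1) * cosTransform k l := by
  have hon : Orthonormal ℝ (({0} : Set (Fin (k + 1))).domRestrict fun _ => e) := by
    refine ⟨fun i => he, fun i j hij => absurd (Subsingleton.elim i j) hij⟩
  obtain ⟨v, hv⟩ := hon.exists_orthonormalBasis_extension_of_card_eq (by simp)
  have hv0 : v 0 = e := hv 0 rfl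
  have h := v.repr.measurePreserving.setIntegral_preimage_emb
    v.repr.toHomeomorph.measurableEmbedding (fun y : E (k + 1) => Real.cos (l * y 0))
    (Metric.closedBall 0 1)
  rw [setIntegral_closedBall_comp_fst k (φ := fun s => Real.cos (l * s)) (by fun_prop)] at h
  rw [cosTransform, ← h]
  have hpre : v.repr ⁻¹' Metric.closedBall 0 1 = Metric.closedBall (0 : E (k + 1)) 1 := by
    ext x; simp
  rw [hpre]
  refine integral_congr_ae (ae_of_all _ fun x => ?_)
  simp only [v.repr_apply_apply, hv0, real_inner_comm]

/-- The decay of the Fourier transform of a ball, uniform in the radius and the frequency. -/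
lemma exists_ballTransform_bound (d : ℕ) (hd : 1 ≤ d) :
    ∃ C : ℝ, 0 ≤ C ∧ ∀ R : ℝ, 0 < R → ∀ w : E d, w ≠ 0 →
      ‖ballTransform d R w‖ ^ 2 ≤ C * R ^ (d - 1) / ‖w‖ ^ (d + 1) := by
  obtain ⟨k, rfl⟩ : ∃ k, d = k + 1 := ⟨d - 1, by omega⟩
  obtain ⟨C, hC0, hC⟩ := exists_cosTransform_bound k
  set V := volume.real (Metric.closedBall (0 : E k) 1)
  refine ⟨V ^ 2 * C / (2 * Real.pi) ^ (k + 2), by positivity, fun R hR w hw => ?_⟩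
  have hw0 : 0 < ‖w‖ := norm_pos_iff.2 hw
  have hscale : ∫ x in Metric.closedBall (0 : E (k + 1)) R, Real.cos (2 * Real.pi * inner ℝ x w)
      = R ^ (k + 1) * (V * cosTransform k (2 * Real.pi * (R * ‖w‖))) := by
    have h := Measure.setIntegral_comp_smul_of_pos (volume : Measure (E (k + 1)))
      (fun x => Real.cos (2 * Real.pi * inner ℝ x w)) (Metric.closedBall 0 1) hR
    rw [smul_unitClosedBall_of_nonneg hR.le, finrank_euclideanSpace, Fintype.card_fin,
      smul_eq_mul] at h
    rw [← setIntegral_closedBall_cos_inner k _ (‖w‖⁻¹ • w) (norm_smul_inv_norm hw)]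
    have h' : ∀ x : E (k + 1), Real.cos (2 * Real.pi * inner ℝ (R • x) w)
        = Real.cos (2 * Real.pi * (R * ‖w‖) * inner ℝ x (‖w‖⁻¹ • w)) := by
      intro x
      rw [real_inner_smul_left, real_inner_smul_right]
      congr 1
      field_simp
    simp only [h'] at h
    rw [h]
    field_simp
  rw [ballTransform_eq_integral_cos, Complex.norm_real, Real.norm_eq_abs, sq_abs, hscale]
  have h := hC (2 * Real.pi * (R * ‖w‖)) (by positivity)
  set J := cosTransform k (2 * Real.pi * (R * ‖w‖)) ^ 2 with hJ
  rw [le_div_iff₀ (by positivity)]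
  simp only [Nat.add_sub_cancel]
  have e : (R ^ (k + 1) * (V * cosTransform k (2 * Real.pi * (R * ‖w‖)))) ^ 2 * ‖w‖ ^ (k + 1 + 1)
      = (V ^ 2 * R ^ k / (2 * Real.pi) ^ (k + 2)) * ((2 * Real.pi * (R * ‖w‖)) ^ (k + 2) * J) := by
    rw [hJ, mul_pow (2 * Real.pi), mul_pow R]
    field_simp
    ring
  rw [e]
  calc _ ≤ (V ^ 2 * R ^ k / (2 * Real.pi) ^ (k + 2)) * C := by gcongr
    _ = _ := by ring

/-! ### Fourier analysis on the flat torus -/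

variable {d : ℕ}

/-- The normalized Haar measure on the circle. Mathlib's multivariate Fourier series use this
instance, which is not syntactically equal to the global one on `AddCircle 1`. -/
local instance circleMeasureSpace : MeasureSpace UnitAddCircle := ⟨AddCircle.haarAddCircle⟩

/-- The projection of Euclidean space to the standard torus given by the coordinates with respect
to the lattice basis. -/
def toTorus (b : Module.Basis (Fin d) ℝ (E d)) (x : E d) : UnitAddTorus (Fin d) :=
  fun i => ((b.repr x i : ℝ) : UnitAddCircle)

/-- The section of `toTorus` with values in the fundamental cell. -/
def ofTorus (b : Module.Basis (Fin d) ℝ (E d)) (t : UnitAddTorus (Fin d)) : E d :=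
  b.equivFun.symm fun i => (AddCircle.equivIco (1 : ℝ) 0 (t i) : ℝ)

lemma toTorus_ofTorus (b : Module.Basis (Fin d) ℝ (E d)) (t : UnitAddTorus (Fin d)) :
    toTorus b (ofTorus b t) = t := by
  funext i
  have : b.repr (ofTorus b t) i = (AddCircle.equivIco (1 : ℝ) 0 (t i) : ℝ) := by
    rw [← b.equivFun_apply, ofTorus, LinearEquiv.apply_symm_apply]
  rw [toTorus, this]
  exact (AddCircle.equivIco (1 : ℝ) 0).symm_apply_apply (t i)

lemma ofTorus_toTorus (b : Module.Basis (Fin d) ℝ (E d)) {x : E d} (hx : x ∈ cell b) :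
    ofTorus b (toTorus b x) = x := by
  rw [ofTorus, LinearEquiv.symm_apply_eq]
  funext i
  have hx' : b.repr x i ∈ Set.Ico (0 : ℝ) (0 + 1) := by
    simpa using ZSpan.mem_fundamentalDomain b |>.1 hx i
  rw [b.equivFun_apply, toTorus]
  have := (AddCircle.equivIco (1 : ℝ) 0).apply_symm_apply ⟨b.repr x i, hx'⟩
  exact congrArg Subtype.val this

lemma continuous_toTorus (b : Module.Basis (Fin d) ℝ (E d)) : Continuous (toTorus b) := by
  refine continuous_pi fun i => (AddCircle.continuous_mk' (1 : ℝ)).comp ?_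
  exact LinearMap.continuous_of_finiteDimensional (b.coord i)

lemma measurable_ofTorus (b : Module.Basis (Fin d) ℝ (E d)) : Measurable (ofTorus b) := by
  refine (LinearMap.continuous_of_finiteDimensional
    (b.equivFun.symm : (Fin d → ℝ) →ₗ[ℝ] E d)).measurable.comp ?_
  refine measurable_pi_lambda _ fun i => ?_
  exact measurable_subtype_coe.comp
    ((AddCircle.measurableEquivIco (1 : ℝ) 0).measurable.comp (measurable_pi_apply i))

lemma measurableSet_cell (b : Module.Basis (Fin d) ℝ (E d)) : MeasurableSet (cell b) :=
  ZSpan.fundamentalDomain_measurableSet b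

lemma isBounded_cell (b : Module.Basis (Fin d) ℝ (E d)) : Bornology.IsBounded (cell b) :=
  ZSpan.fundamentalDomain_isBounded b

lemma volume_cell_ne_zero (b : Module.Basis (Fin d) ℝ (E d)) : volume (cell b) ≠ 0 :=
  ZSpan.measure_fundamentalDomain_ne_zero b

lemma volume_cell_ne_top (b : Module.Basis (Fin d) ℝ (E d)) : volume (cell b) ≠ ⊤ :=
  (isBounded_cell b).measure_lt_top.ne

instance isProbabilityMeasure_mu (b : Module.Basis (Fin d) ℝ (E d)) :
    IsProbabilityMeasure (mu b) :=
  ⟨by simp [mu, ENNReal.inv_mul_cancel (volume_cell_ne_zero b) (volume_cell_ne_top b)]⟩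

lemma ae_mem_cell (b : Module.Basis (Fin d) ℝ (E d)) : ∀ᵐ x ∂mu b, x ∈ cell b :=
  Measure.ae_smul_measure (ae_restrict_mem (measurableSet_cell b)) _

lemma integral_mu {F : Type*} [NormedAddCommGroup F] [NormedSpace ℝ F]
    (b : Module.Basis (Fin d) ℝ (E d)) (f : E d → F) :
    ∫ x, f x ∂mu b = (volume.real (cell b))⁻¹ • ∫ x in cell b, f x := by
  rw [mu, integral_smul_measure, ENNReal.toReal_inv, Measure.real]

lemma measurePreserving_equivFun (b : Module.Basis (Fin d) ℝ (E d)) :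
    MeasurePreserving b.equivFun (mu b)
      (volume.restrict (Set.univ.pi fun _ : Fin d => Set.Ico (0 : ℝ) 1)) := by
  let e : E d ≃L[ℝ] (Fin d → ℝ) := b.equivFun.toContinuousLinearEquiv
  have hem : Measurable b.equivFun := e.continuous.measurable
  refine ⟨hem, ?_⟩
  set P := Set.univ.pi fun _ : Fin d => Set.Ico (0 : ℝ) 1 with hP
  have hPm : MeasurableSet P := MeasurableSet.univ_pi fun _ => measurableSet_Ico
  have hpre : b.equivFun ⁻¹' P = cell b := by
    ext x
    simp [hP, cell, ZSpan.mem_fundamentalDomain, Set.mem_pi]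
  have : (Measure.map b.equivFun (volume : Measure (E d))).IsAddHaarMeasure :=
    e.isAddHaarMeasure_map volume
  have hsm := Measure.isAddLeftInvariant_eq_smul (Measure.map b.equivFun (volume : Measure (E d)))
    (volume : Measure (Fin d → ℝ))
  set c := Measure.addHaarScalarFactor (Measure.map b.equivFun (volume : Measure (E d)))
    (volume : Measure (Fin d → ℝ)) with hc
  have hvol : volume P = 1 := by simp [hP, volume_pi_pi]
  have hc1 : volume (cell b) = (c : ENNReal) := by
    rw [← hpre, ← Measure.map_apply hem hPm, hsm]
    simp [hvol]
  rw [mu, Measure.map_smul, ← hpre, ← Measure.restrict_map hem hPm, hsm, hpre, hc1,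
    Measure.restrict_smul]
  have h0 : (c : ENNReal) ≠ 0 := hc1 ▸ volume_cell_ne_zero b
  rw [ENNReal.smul_def, smul_smul, ENNReal.inv_mul_cancel h0 ENNReal.coe_ne_top, one_smul]

lemma measurePreserving_toTorus (b : Module.Basis (Fin d) ℝ (E d)) :
    MeasurePreserving (toTorus b) (mu b) volume := by
  have h1 : MeasurePreserving (fun x : ℝ => (x : UnitAddCircle)) (volume.restrict (Set.Ioc 0 1))
      AddCircle.haarAddCircle := by
    have := AddCircle.measurePreserving_mk (1 : ℝ) 0
    rw [AddCircle.volume_eq_smul_haarAddCircle] at this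
    simpa using! this
  have h2 := measurePreserving_pi (fun _ : Fin d => volume.restrict (Set.Ioc (0 : ℝ) 1))
    (fun _ => AddCircle.haarAddCircle) (fun _ => h1)
  have h3 : (volume : Measure (Fin d → ℝ)).restrict (Set.univ.pi fun _ : Fin d => Set.Ico 0 1)
      = Measure.pi (fun _ : Fin d => volume.restrict (Set.Ioc (0 : ℝ) 1)) := by
    rw [volume_pi, Measure.restrict_pi_pi]
    congr 1
    funext i
    exact Measure.restrict_congr_set Ico_ae_eq_Ioc
  have h4 := measurePreserving_equivFun b
  rw [h3] at h4
  exact h2.comp h4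

lemma measurePreserving_ofTorus (b : Module.Basis (Fin d) ℝ (E d)) :
    MeasurePreserving (ofTorus b) volume (mu b) := by
  refine ⟨measurable_ofTorus b, ?_⟩
  rw [← (measurePreserving_toTorus b).map_eq,
    Measure.map_map (measurable_ofTorus b) (measurePreserving_toTorus b).measurable]
  have : ofTorus b ∘ toTorus b =ᵐ[mu b] id := by
    filter_upwards [ae_mem_cell b] with x hx using ofTorus_toTorus b hx
  rw [Measure.map_congr this, Measure.map_id]

/-- The character `x ↦ exp (2 π i ⟪dualVec b n, x⟫)` of the flat torus, as the pullback of a Fourier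
monomial on the standard torus; see `char_eq_exp`. -/
def char (b : Module.Basis (Fin d) ℝ (E d)) (n : Fin d → ℤ) (x : E d) : ℂ :=
  UnitAddTorus.mFourier n (toTorus b x)

lemma continuous_char (b : Module.Basis (Fin d) ℝ (E d)) (n : Fin d → ℤ) :
    Continuous (char b n) :=
  (UnitAddTorus.mFourier n).continuous.comp (continuous_toTorus b)

/-- Parseval's identity on the flat torus. -/
lemma hasSum_sq_norm_integral_char (b : Module.Basis (Fin d) ℝ (E d)) {f : E d → ℂ}
    (hf : MemLp f 2 (mu b)) :
    HasSum (fun n : Fin d → ℤ => ‖∫ x, char b (-n) x * f x ∂mu b‖ ^ 2) (∫ x, ‖f x‖ ^ 2 ∂mu b) := by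
  have hmp := measurePreserving_ofTorus b
  have hg := hf.comp_measurePreserving hmp
  have h := UnitAddTorus.hasSum_sq_mFourierCoeff (hg.toLp _)
  have e1 : ∫ t, ‖hg.toLp _ t‖ ^ 2 = ∫ x, ‖f x‖ ^ 2 ∂mu b := by
    have : ∫ t, ‖hg.toLp _ t‖ ^ 2 = ∫ t, ‖f (ofTorus b t)‖ ^ 2 := by
      refine integral_congr_ae ?_
      filter_upwards [hg.coeFn_toLp] with t ht
      rw [ht]; rfl
    rw [this, ← hmp.map_eq, integral_map hmp.measurable.aemeasurable]
    rw [hmp.map_eq]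
    exact (hf.1.norm.pow 2)
  have e2 : ∀ n : Fin d → ℤ, UnitAddTorus.mFourierCoeff (hg.toLp _) n
      = ∫ x, char b (-n) x * f x ∂mu b := by
    intro n
    have : UnitAddTorus.mFourierCoeff (hg.toLp _) n
        = ∫ t, char b (-n) (ofTorus b t) * f (ofTorus b t) := by
      refine integral_congr_ae ?_
      filter_upwards [hg.coeFn_toLp] with t ht
      rw [ht, char, toTorus_ofTorus]; rfl
    rw [this, ← hmp.map_eq, integral_map hmp.measurable.aemeasurable]
    rw [hmp.map_eq]
    exact (continuous_char b _).aestronglyMeasurable.mul hf.1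
  simp only [e2] at h
  rwa [e1] at h

lemma char_add (b : Module.Basis (Fin d) ℝ (E d)) (m n : Fin d → ℤ) (x : E d) :
    char b (m + n) x = char b m x * char b n x := UnitAddTorus.mFourier_add

lemma char_neg (b : Module.Basis (Fin d) ℝ (E d)) (n : Fin d → ℤ) (x : E d) :
    char b (-n) x = (starRingEnd ℂ) (char b n x) := UnitAddTorus.mFourier_neg

lemma char_zero (b : Module.Basis (Fin d) ℝ (E d)) (x : E d) : char b 0 x = 1 := by
  rw [char, UnitAddTorus.mFourier_zero]; rfl

lemma char_eq_exp (b : Module.Basis (Fin d) ℝ (E d)) (n : Fin d → ℤ) (x : E d) :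
    char b n x = Complex.exp (2 * Real.pi * Complex.I * ((∑ i, n i * b.repr x i : ℝ) : ℂ)) := by
  have : char b n x = ∏ i, fourier (n i) ((b.repr x i : ℝ) : UnitAddCircle) := rfl
  rw [this]
  simp only [fourier_coe_apply, Complex.ofReal_one, div_one]
  rw [← Complex.exp_sum]
  congr 1
  push_cast
  rw [Finset.mul_sum]
  exact Finset.sum_congr rfl fun i _ => by ring

lemma norm_char (b : Module.Basis (Fin d) ℝ (E d)) (n : Fin d → ℤ) (x : E d) :
    ‖char b n x‖ = 1 := by
  rw [char_eq_exp]
  have : (2 * Real.pi * Complex.I * ((∑ i, n i * b.repr x i : ℝ) : ℂ))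
      = ((2 * Real.pi * ∑ i, n i * b.repr x i : ℝ) : ℂ) * Complex.I := by push_cast; ring
  rw [this, Complex.norm_exp_ofReal_mul_I]

lemma char_apply_add (b : Module.Basis (Fin d) ℝ (E d)) (n : Fin d → ℤ) (x y : E d) :
    char b n (x + y) = char b n x * char b n y := by
  simp only [char_eq_exp, ← Complex.exp_add, ← mul_add, ← Complex.ofReal_add,
    ← Finset.sum_add_distrib, map_add, Finsupp.add_apply]

lemma char_apply_lattice (b : Module.Basis (Fin d) ℝ (E d)) (n : Fin d → ℤ) {v : E d}
    (hv : v ∈ lattice b) : char b n v = 1 := by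
  have h := (b.mem_span_iff_repr_mem ℤ v).1 hv
  have : toTorus b v = 0 := by
    funext i
    obtain ⟨m, hm⟩ := h i
    simp only [toTorus, Pi.zero_apply]
    rw [AddCircle.coe_eq_zero_iff]
    exact ⟨m, by simpa using hm⟩
  rw [char, this]
  simp [UnitAddTorus.mFourier]

lemma integral_char (b : Module.Basis (Fin d) ℝ (E d)) (n : Fin d → ℤ) :
    ∫ x, char b n x ∂mu b = if n = 0 then 1 else 0 := by
  have hmp := measurePreserving_toTorus b
  have h := (orthonormal_iff_ite.1 (UnitAddTorus.orthonormal_mFourier (d := Fin d))) 0 n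
  simp only [ContinuousMap.inner_toLp, UnitAddTorus.mFourier_zero] at h
  have e : ∫ x, char b n x ∂mu b = ∫ t, UnitAddTorus.mFourier n t := by
    rw [← hmp.map_eq, integral_map hmp.measurable.aemeasurable]
    · rfl
    · exact (UnitAddTorus.mFourier n).continuous.aestronglyMeasurable
  rw [e]
  simpa [eq_comm] using! h

/-- The dual lattice vector with coordinates `n` with respect to the dual basis. -/
def dualVec (b : Module.Basis (Fin d) ℝ (E d)) (n : Fin d → ℤ) : E d :=
  ∑ i, (n i : ℝ) • (InnerProductSpace.toDual ℝ (E d)).symm (b.coord i).toContinuousLinearMap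

lemma inner_dualVec (b : Module.Basis (Fin d) ℝ (E d)) (n : Fin d → ℤ) (x : E d) :
    inner ℝ (dualVec b n) x = ∑ i, n i * b.repr x i := by
  simp only [dualVec, sum_inner, real_inner_smul_left, InnerProductSpace.toDual_symm_apply]
  rfl

lemma inner_dualVec_basis (b : Module.Basis (Fin d) ℝ (E d)) (n : Fin d → ℤ) (i : Fin d) :
    inner ℝ (dualVec b n) (b i) = n i := by
  rw [inner_dualVec, Finset.sum_eq_single i]
  · simp
  · intro j _ hj; simp [hj.symm]
  · simp

lemma dualVec_mem (b : Module.Basis (Fin d) ℝ (E d)) (n : Fin d → ℤ) :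
    dualVec b n ∈ dualLattice b := by
  intro v hv
  have h := (b.mem_span_iff_repr_mem ℤ v).1 hv
  choose m hm using h
  refine ⟨∑ i, n i * m i, ?_⟩
  rw [inner_dualVec]
  push_cast
  refine Finset.sum_congr rfl fun i _ => ?_
  rw [← hm i]; simp

/-- The dual lattice is parametrized by integer vectors through the dual basis. -/
def dualEquiv (b : Module.Basis (Fin d) ℝ (E d)) : (Fin d → ℤ) ≃ dualLattice b :=
  Equiv.ofBijective (fun n => ⟨dualVec b n, dualVec_mem b n⟩) (by
    constructor
    · intro m n h
      funext i
      have h' : dualVec b m = dualVec b n := congrArg Subtype.val h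
      have := inner_dualVec_basis b m i
      rw [h', inner_dualVec_basis] at this
      exact_mod_cast this.symm
    · rintro ⟨w, hw⟩
      have hb : ∀ i, b i ∈ lattice b := fun i => Submodule.subset_span ⟨i, rfl⟩
      choose n hn using fun i => hw (b i) (hb i)
      refine ⟨n, Subtype.ext ?_⟩
      refine InnerProductSpace.ext_inner_right_basis b fun i => ?_
      exact (inner_dualVec_basis b n i).trans (hn i).symm)

lemma coe_dualEquiv (b : Module.Basis (Fin d) ℝ (E d)) (n : Fin d → ℤ) :
    (dualEquiv b n : E d) = dualVec b n := rfl

lemma exp_inner_dualVec (b : Module.Basis (Fin d) ℝ (E d)) (n : Fin d → ℤ) (x : E d) :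
    Complex.exp (-(2 * Real.pi * Complex.I * ((inner ℝ x (dualVec b n) : ℝ) : ℂ)))
      = char b (-n) x := by
  rw [char_neg, char_eq_exp, ← Complex.exp_conj, real_inner_comm, inner_dualVec]
  congr 1
  simp only [map_mul, Complex.conj_ofReal, Complex.conj_I, map_ofNat]
  ring

/-- A dual lattice vector is bounded below by the sup norm of its coordinates. -/
lemma exists_norm_le_norm_dualVec (b : Module.Basis (Fin d) ℝ (E d)) :
    ∃ c : ℝ, 0 < c ∧ ∀ n : Fin d → ℤ, c * ‖n‖ ≤ ‖dualVec b n‖ := by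
  set M := 1 + ∑ i, ‖b i‖ with hM
  have hMpos : 0 < M := by positivity
  refine ⟨M⁻¹, by positivity, fun n => ?_⟩
  rw [inv_mul_le_iff₀ hMpos]
  refine (pi_norm_le_iff_of_nonneg (by positivity)).2 fun i => ?_
  have h1 : ‖n i‖ = |inner ℝ (dualVec b n) (b i)| := by
    rw [inner_dualVec_basis, Int.norm_eq_abs]
  have h2 : ‖b i‖ ≤ M := by
    have := Finset.single_le_sum (f := fun i => ‖b i‖) (fun i _ => norm_nonneg _)
      (Finset.mem_univ i)
    simp only [hM]; linarith
  calc ‖n i‖ ≤ ‖dualVec b n‖ * ‖b i‖ := h1 ▸ abs_real_inner_le_norm _ _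
    _ ≤ ‖dualVec b n‖ * M := by gcongr
    _ = _ := mul_comm _ _

/-- A dual lattice vector is bounded above by the sup norm of its coordinates. -/
lemma exists_norm_dualVec_le (b : Module.Basis (Fin d) ℝ (E d)) :
    ∃ c : ℝ, 0 < c ∧ ∀ n : Fin d → ℤ, ‖dualVec b n‖ ≤ c * ‖n‖ := by
  set u : Fin d → E d := fun i =>
    (InnerProductSpace.toDual ℝ (E d)).symm (b.coord i).toContinuousLinearMap
  refine ⟨1 + ∑ i, ‖u i‖, by positivity, fun n => ?_⟩
  calc ‖dualVec b n‖ ≤ ∑ i, ‖(n i : ℝ) • u i‖ := norm_sum_le _ _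
    _ ≤ ∑ i, ‖n‖ * ‖u i‖ := by
        refine Finset.sum_le_sum fun i _ => ?_
        rw [norm_smul]
        gcongr
        exact (by simp [Int.norm_eq_abs] : ‖(n i : ℝ)‖ = ‖n i‖).le.trans (norm_le_pi_norm n i)
    _ = (∑ i, ‖u i‖) * ‖n‖ := by rw [← Finset.mul_sum, mul_comm]
    _ ≤ _ := by gcongr; linarith

/-! ### The Fourier expansion of the number variance -/

/-- The exponential sum of a point configuration at the frequency `n`. -/
def expSum (b : Module.Basis (Fin d) ℝ (E d)) {N : ℕ} (X : Fin N → E d) (n : Fin d → ℤ) : ℂ :=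
  ∑ j, char b n (X j)

/-- The number of lattice translates of `p` in the ball `B(x, R)`. -/
def pointCount (b : Module.Basis (Fin d) ℝ (E d)) (R : ℝ) (p x : E d) : ℝ :=
  ∑' v : lattice b, (Metric.closedBall x R).indicator (fun _ => (1 : ℝ)) (p + (v : E d))

lemma indicator_closedBall_comm (R : ℝ) (x y : E d) :
    (Metric.closedBall x R).indicator (fun _ => (1 : ℝ)) y
      = (Metric.closedBall y R).indicator (fun _ => (1 : ℝ)) x := by
  simp only [Set.indicator, Metric.mem_closedBall, dist_comm]

/-- Only finitely many lattice translates of `p` come within distance `R` of the cell. -/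
lemma exists_finset_translates (b : Module.Basis (Fin d) ℝ (E d)) (R : ℝ) (p : E d) :
    ∃ V : Finset (lattice b), ∀ x ∈ cell b, ∀ v ∉ V, p + (v : E d) ∉ Metric.closedBall x R := by
  obtain ⟨ρ, hρ⟩ := (isBounded_cell b).subset_closedBall (0 : E d)
  have hfin : {v : lattice b | (v : E d) ∈ Metric.closedBall (0 : E d) (R + ρ + ‖p‖)}.Finite := by
    have := ZSpan.setFinite_inter b
      (Metric.isBounded_closedBall (x := (0 : E d)) (r := R + ρ + ‖p‖))
    refine (this.preimage Subtype.val_injective.injOn).subset fun v hv => ?_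
    exact ⟨hv, v.2⟩
  refine ⟨hfin.toFinset, fun x hx v hv hmem => hv ?_⟩
  rw [Set.Finite.mem_toFinset]
  have h1 := mem_closedBall_zero_iff.1 (hρ hx)
  rw [Metric.mem_closedBall, dist_eq_norm] at hmem
  refine mem_closedBall_zero_iff.2 ?_
  calc ‖(v : E d)‖ = ‖(p + (v : E d) - x) + x - p‖ := by congr 1; abel
    _ ≤ ‖p + (v : E d) - x‖ + ‖x‖ + ‖p‖ :=
        (norm_sub_le _ _).trans (by gcongr; exact norm_add_le _ _)
    _ ≤ _ := by gcongr

/-- On the cell the number of translates is a finite sum of indicator functions of balls. -/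
lemma exists_pointCount_eq (b : Module.Basis (Fin d) ℝ (E d)) (R : ℝ) (p : E d) :
    ∃ V : Finset (lattice b), (∀ x ∈ cell b, ∀ v ∉ V,
      (Metric.closedBall (p + (v : E d)) R).indicator (fun _ => (1 : ℝ)) x = 0) ∧
      ∀ x ∈ cell b, pointCount b R p x
        = ∑ v ∈ V, (Metric.closedBall (p + (v : E d)) R).indicator (fun _ => (1 : ℝ)) x := by
  obtain ⟨V, hV⟩ := exists_finset_translates b R p
  have h0 : ∀ x ∈ cell b, ∀ v ∉ V,
      (Metric.closedBall (p + (v : E d)) R).indicator (fun _ => (1 : ℝ)) x = 0 := by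
    intro x hx v hv
    rw [indicator_closedBall_comm]
    exact Set.indicator_of_notMem (hV x hx v hv) _
  refine ⟨V, h0, fun x hx => ?_⟩
  simp only [pointCount, indicator_closedBall_comm R x]
  exact tsum_eq_sum fun v hv => h0 x hx v hv

lemma memLp_pointCount (b : Module.Basis (Fin d) ℝ (E d)) (R : ℝ) (p : E d) :
    MemLp (pointCount b R p) ⊤ (mu b) := by
  obtain ⟨V, -, hV⟩ := exists_pointCount_eq b R p
  have hae : (fun x => ∑ v ∈ V, (Metric.closedBall (p + (v : E d)) R).indicator
      (fun _ => (1 : ℝ)) x) =ᵐ[mu b] pointCount b R p := by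
    filter_upwards [ae_mem_cell b] with x hx using (hV x hx).symm
  refine MemLp.ae_eq hae (memLp_finsetSum V fun v _ => ?_)
  exact memLp_indicator_const _ measurableSet_closedBall _ (Or.inr (measure_ne_top _ _))

lemma setIntegral_closedBall_char (b : Module.Basis (Fin d) ℝ (E d)) (R : ℝ) (p : E d)
    (n : Fin d → ℤ) : ∫ x in Metric.closedBall p R, char b (-n) x
      = char b (-n) p * ballTransform d R (dualVec b n) := by
  simp only [ballTransform, exp_inner_dualVec]
  rw [← integral_const_mul, ← integral_indicator measurableSet_closedBall,
    ← integral_indicator measurableSet_closedBall, ← integral_add_left_eq_self _ p]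
  refine integral_congr_ae (ae_of_all _ fun x => ?_)
  simp [Set.indicator, char_apply_add]

/-- The Fourier coefficients of the number of lattice translates in a moving ball, by unfolding. -/
lemma integral_char_mul_pointCount (b : Module.Basis (Fin d) ℝ (E d)) (R : ℝ) (p : E d)
    (n : Fin d → ℤ) :
    ∫ x, char b (-n) x * (pointCount b R p x : ℂ) ∂mu b
      = (volume.real (cell b))⁻¹ • (char b (-n) p * ballTransform d R (dualVec b n)) := by
  obtain ⟨V, hV0, hV⟩ := exists_pointCount_eq b R p
  rw [integral_mu]
  congr 1
  set h : E d → ℂ := (Metric.closedBall p R).indicator (char b (-n)) with hh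
  have hhi : Integrable h := ((continuous_char b (-n)).continuousOn.integrableOn_compact
    (isCompact_closedBall p R)).integrable_indicator measurableSet_closedBall
  have hterm : ∀ v : lattice b, ∀ x, h (-v +ᵥ x) = char b (-n) x
      * (((Metric.closedBall (p + (v : E d)) R).indicator (fun _ => (1 : ℝ)) x : ℝ) : ℂ) := by
    intro v x
    have e1 : char b (-n) (-v +ᵥ x) = char b (-n) x := by
      change char b (-n) (((-v : lattice b) : E d) + x) = _
      rw [char_apply_add, char_apply_lattice b _ (-v).2, one_mul]
    have e2 : -v +ᵥ x ∈ Metric.closedBall p R ↔ x ∈ Metric.closedBall (p + (v : E d)) R := by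
      change ((-v : lattice b) : E d) + x ∈ _ ↔ _
      rw [Metric.mem_closedBall, Metric.mem_closedBall, dist_eq_norm, dist_eq_norm]
      have : ((-v : lattice b) : E d) + x - p = x - (p + v) := by push_cast; abel
      rw [this]
    by_cases hx : x ∈ Metric.closedBall (p + (v : E d)) R
    · rw [hh, Set.indicator_of_mem (e2.2 hx), e1, Set.indicator_of_mem hx]; simp
    · rw [hh, Set.indicator_of_notMem (fun hc => hx (e2.1 hc)), Set.indicator_of_notMem hx]; simp
  have hfd : IsAddFundamentalDomain (lattice b) (cell b) volume :=
    ZSpan.isAddFundamentalDomain b volume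
  have hcount : Countable (lattice b) :=
    inferInstanceAs (Countable (Submodule.span ℤ (Set.range b)))
  have hinv : VAddInvariantMeasure (lattice b) (E d) volume :=
    ⟨fun v s _ => measure_preimage_add volume (v : E d) s⟩
  have hunfold := hfd.integral_eq_tsum' h hhi
  rw [hh, integral_indicator measurableSet_closedBall, setIntegral_closedBall_char, ← hh] at hunfold
  rw [hunfold, tsum_eq_sum (s := V)]
  · rw [← integral_finsetSum]
    · refine setIntegral_congr_fun (measurableSet_cell b) fun x hx => ?_
      simp only [hterm]
      rw [hV x hx, ← Finset.mul_sum, Complex.ofReal_sum]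
    · intro v _
      have := hhi.comp_add_left ((-v : lattice b) : E d)
      exact this.integrableOn
  · intro v hv
    refine (setIntegral_congr_fun (measurableSet_cell b) (g := fun _ => 0) fun x hx => ?_).trans
      (by simp)
    simp only [hterm, hV0 x hx v hv]
    simp

lemma ballCount_eq_sum (b : Module.Basis (Fin d) ℝ (E d)) {N : ℕ} (X : Fin N → E d) (x : E d)
    (R : ℝ) : ballCount b X x R = ∑ j, pointCount b R (X j) x := rfl

lemma ballTransform_zero (R : ℝ) :
    ballTransform d R 0 = (volume.real (Metric.closedBall (0 : E d) R) : ℂ) := by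
  simp [ballTransform, Measure.real]

lemma dualVec_zero (b : Module.Basis (Fin d) ℝ (E d)) : dualVec b 0 = 0 := by
  simp [dualVec]

/-- The Fourier expansion of the number variance. -/
lemma hasSum_numberVariance (b : Module.Basis (Fin d) ℝ (E d)) {N : ℕ} (X : Fin N → E d) (R : ℝ) :
    HasSum (fun n : Fin d → ℤ => if n = 0 then 0 else
      ‖expSum b X n‖ ^ 2 * ((volume.real (cell b))⁻¹ ^ 2
        * ‖ballTransform d R (dualVec b n)‖ ^ 2)) (numberVariance b X R) := by
  set g : E d → ℝ := fun x => ballCount b X x R - (N : ℝ) * ballVol b R with hg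
  have hcount : MemLp (fun x => ballCount b X x R) ⊤ (mu b) :=
    memLp_finsetSum Finset.univ fun j _ => memLp_pointCount b R (X j)
  have hgm : MemLp g ⊤ (mu b) := hcount.sub (memLp_const _)
  have hgc : MemLp (fun x => (g x : ℂ)) 2 (mu b) :=
    (hgm.ofReal (K := ℂ)).mono_exponent le_top
  have h := hasSum_sq_norm_integral_char b hgc
  have e1 : ∫ x, ‖(g x : ℂ)‖ ^ 2 ∂mu b = numberVariance b X R := by
    refine integral_congr_ae (ae_of_all _ fun x => ?_)
    simp only [Complex.norm_real, Real.norm_eq_abs, sq_abs, hg]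
  rw [e1] at h
  convert h using 2 with n
  have hp : ∀ j, Integrable (fun x => char b (-n) x * (pointCount b R (X j) x : ℂ)) (mu b) := by
    intro j
    have h1 : Integrable (fun x => (pointCount b R (X j) x : ℂ)) (mu b) :=
      (((memLp_pointCount b R (X j)).integrable le_top)).ofReal
    exact h1.bdd_mul (c := 1) (continuous_char b _).aestronglyMeasurable
      (ae_of_all _ fun x => (norm_char b _ x).le)
  have hci : Integrable (fun x => char b (-n) x * ((N : ℝ) * ballVol b R : ℂ)) (mu b) :=
    (Integrable.of_bound (continuous_char b _).aestronglyMeasurable 1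
      (ae_of_all _ fun x => (norm_char b _ x).le)).mul_const _
  have e2 : ∫ x, char b (-n) x * (g x : ℂ) ∂mu b
      = (volume.real (cell b))⁻¹ • (expSum b X (-n) * ballTransform d R (dualVec b n))
        - (if n = 0 then 1 else 0) * ((N : ℝ) * ballVol b R : ℂ) := by
    have : ∀ x, char b (-n) x * (g x : ℂ)
        = ∑ j, char b (-n) x * (pointCount b R (X j) x : ℂ)
          - char b (-n) x * ((N : ℝ) * ballVol b R : ℂ) := by
      intro x
      simp only [hg, ballCount_eq_sum]
      push_cast
      rw [mul_sub, Finset.mul_sum]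
    simp only [this]
    rw [integral_sub (integrable_finsetSum _ fun j _ => hp j) hci,
      integral_finsetSum _ fun j _ => hp j, integral_mul_const, integral_char]
    simp only [integral_char_mul_pointCount, neg_eq_zero]
    rw [← Finset.smul_sum, ← Finset.sum_mul]
    rfl
  rw [e2]
  by_cases hn : n = 0
  · subst hn
    simp [expSum, char_zero, dualVec_zero, ballTransform_zero, ballVol]
    ring_nf
    simp
  · have hneg : ‖expSum b X (-n)‖ = ‖expSum b X n‖ := by
      simp only [expSum, char_neg, ← map_sum, RCLike.norm_conj]
    simp only [hn, if_false, zero_mul, sub_zero, norm_smul, norm_mul, hneg, norm_inv,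
      Real.norm_of_nonneg (measureReal_nonneg (μ := volume) (s := cell b))]
    ring

/-! ### Exponential sums of QMC designs -/

/-- The weight of the frequency `n` in the square of the Sobolev norm. -/
def sobolevWeight (b : Module.Basis (Fin d) ℝ (E d)) (α : ℝ) (n : Fin d → ℤ) : ℝ :=
  (1 + 4 * Real.pi ^ 2 * ‖dualVec b n‖ ^ 2) ^ α

lemma sobolevWeight_pos (b : Module.Basis (Fin d) ℝ (E d)) (α : ℝ) (n : Fin d → ℤ) :
    0 < sobolevWeight b α n := by
  unfold sobolevWeight; positivity

lemma dualVec_neg (b : Module.Basis (Fin d) ℝ (E d)) (n : Fin d → ℤ) :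
    dualVec b (-n) = -dualVec b n := by
  simp [dualVec]

lemma sobolevWeight_neg (b : Module.Basis (Fin d) ℝ (E d)) (α : ℝ) (n : Fin d → ℤ) :
    sobolevWeight b α (-n) = sobolevWeight b α n := by
  simp only [sobolevWeight, dualVec_neg, norm_neg]

lemma expSum_neg (b : Module.Basis (Fin d) ℝ (E d)) {N : ℕ} (X : Fin N → E d) (n : Fin d → ℤ) :
    expSum b X (-n) = (starRingEnd ℂ) (expSum b X n) := by
  simp only [expSum, char_neg, map_sum]

/-- The trigonometric polynomial with frequencies in `T` that is extremal for the error of the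
cubature rule with nodes `X`. -/
def extremal (b : Module.Basis (Fin d) ℝ (E d)) (α : ℝ) {N : ℕ} (X : Fin N → E d)
    (T : Finset (Fin d → ℤ)) (x : E d) : ℂ :=
  ∑ n ∈ T, ((sobolevWeight b α n)⁻¹ : ℂ) * (starRingEnd ℂ) (expSum b X n) * char b n x

lemma continuous_extremal (b : Module.Basis (Fin d) ℝ (E d)) (α : ℝ) {N : ℕ} (X : Fin N → E d)
    (T : Finset (Fin d → ℤ)) : Continuous (extremal b α X T) :=
  continuous_finsetSum _ fun n _ => continuous_const.mul (continuous_char b n)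

lemma extremal_add_lattice (b : Module.Basis (Fin d) ℝ (E d)) (α : ℝ) {N : ℕ} (X : Fin N → E d)
    (T : Finset (Fin d → ℤ)) (x : E d) {v : E d} (hv : v ∈ lattice b) :
    extremal b α X T (x + v) = extremal b α X T x := by
  simp only [extremal, char_apply_add, char_apply_lattice b _ hv, mul_one]

/-- For a symmetric set of frequencies the extremal polynomial is real valued. -/
lemma ofReal_re_extremal (b : Module.Basis (Fin d) ℝ (E d)) (α : ℝ) {N : ℕ} (X : Fin N → E d)
    {T : Finset (Fin d → ℤ)} (hT : ∀ n ∈ T, -n ∈ T) (x : E d) :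
    ((extremal b α X T x).re : ℂ) = extremal b α X T x := by
  rw [← Complex.conj_eq_iff_re]
  simp only [extremal, map_sum]
  refine Finset.sum_bij' (fun n _ => -n) (fun n _ => -n) hT hT (fun n _ => neg_neg n)
    (fun n _ => neg_neg n) fun n _ => ?_
  simp only [map_mul, map_inv₀, Complex.conj_ofReal, expSum_neg, char_neg, sobolevWeight_neg]

lemma integral_extremal_mul_char (b : Module.Basis (Fin d) ℝ (E d)) (α : ℝ) {N : ℕ}
    (X : Fin N → E d) (T : Finset (Fin d → ℤ)) (m : Fin d → ℤ) :
    ∫ x, extremal b α X T x * char b (-m) x ∂mu b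
      = if m ∈ T then ((sobolevWeight b α m)⁻¹ : ℂ) * (starRingEnd ℂ) (expSum b X m) else 0 := by
  have h : ∀ x, extremal b α X T x * char b (-m) x = ∑ n ∈ T,
      ((sobolevWeight b α n)⁻¹ : ℂ) * (starRingEnd ℂ) (expSum b X n) * char b (n + -m) x := by
    intro x
    rw [extremal, Finset.sum_mul]
    exact Finset.sum_congr rfl fun n _ => by rw [char_add]; ring
  simp only [h]
  rw [integral_finsetSum]
  · simp only [integral_const_mul, integral_char, add_neg_eq_zero, mul_ite, mul_one, mul_zero]
    rw [Finset.sum_ite_eq' T m]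
  · intro n _
    exact (Integrable.of_bound (continuous_char b _).aestronglyMeasurable 1
      (ae_of_all _ fun x => (norm_char b _ x).le)).const_mul _

lemma sum_extremal (b : Module.Basis (Fin d) ℝ (E d)) (α : ℝ) {N : ℕ} (X : Fin N → E d)
    (T : Finset (Fin d → ℤ)) :
    ∑ j, extremal b α X T (X j)
      = ((∑ n ∈ T, (sobolevWeight b α n)⁻¹ * ‖expSum b X n‖ ^ 2 : ℝ) : ℂ) := by
  simp only [extremal]
  rw [Finset.sum_comm]
  push_cast
  refine Finset.sum_congr rfl fun n _ => ?_
  rw [← Finset.mul_sum, ← Complex.conj_mul', mul_assoc]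
  rfl

/-- The worst-case cubature error bounds the weighted sum of the squared exponential sums over
every symmetric finite set of nonzero frequencies. -/
lemma sum_expSum_le_of_symmetric (b : Module.Basis (Fin d) ℝ (E d)) (α : ℝ) {N : ℕ} (hN : 1 ≤ N)
    (X : Fin N → E d) {ε : ℝ}
    (hX : ∀ f : E d → ℝ, MemSobolev b α f →
      |cubature X f - ∫ x, f x ∂(mu b)| ≤ ε * sobolevNorm b α f)
    {T : Finset (Fin d → ℤ)} (hT : ∀ n ∈ T, -n ∈ T) (h0 : 0 ∉ T) :
    ∑ n ∈ T, (sobolevWeight b α n)⁻¹ * ‖expSum b X n‖ ^ 2 ≤ (N * ε) ^ 2 := by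
  set f : E d → ℝ := fun x => (extremal b α X T x).re with hf
  have hfc : ∀ x, (f x : ℂ) = extremal b α X T x := ofReal_re_extremal b α X hT
  set D := ∑ n ∈ T, (sobolevWeight b α n)⁻¹ * ‖expSum b X n‖ ^ 2 with hD
  have hD0 : 0 ≤ D := Finset.sum_nonneg fun n _ =>
    mul_nonneg (inv_nonneg.2 (sobolevWeight_pos b α n).le) (sq_nonneg _)
  have hterm : ∀ m, sobolevTerm b α f (dualEquiv b m)
      = if m ∈ T then (sobolevWeight b α m)⁻¹ * ‖expSum b X m‖ ^ 2 else 0 := by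
    intro m
    have : fourierCoef b f (dualVec b m) = ∫ x, extremal b α X T x * char b (-m) x ∂mu b := by
      simp only [fourierCoef, hfc, exp_inner_dualVec]
    rw [sobolevTerm, coe_dualEquiv, this, integral_extremal_mul_char, ← sobolevWeight]
    split_ifs with h
    · have := sobolevWeight_pos b α m
      rw [norm_mul, RCLike.norm_conj, norm_inv, Complex.norm_real, Real.norm_of_nonneg this.le]
      field_simp
    · simp
  have hsum : HasSum (fun m => sobolevTerm b α f (dualEquiv b m)) D := by
    simp only [hterm]
    have e : ∑ m ∈ T, (if m ∈ T then (sobolevWeight b α m)⁻¹ * ‖expSum b X m‖ ^ 2 else 0) = D :=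
      Finset.sum_congr rfl fun m hm => if_pos hm
    rw [← e]
    exact hasSum_sum_of_ne_finset_zero fun m hm => if_neg hm
  have hsum' : HasSum (fun w : dualLattice b => sobolevTerm b α f w) D :=
    (dualEquiv b).hasSum_iff.1 hsum
  have hmem : MemSobolev b α f :=
    ⟨Complex.continuous_re.comp (continuous_extremal b α X T),
      fun x v hv => by simp only [hf, extremal_add_lattice b α X T x hv], hsum'.summable⟩
  have hnorm : sobolevNorm b α f = Real.sqrt D := by rw [sobolevNorm, hsum'.tsum_eq]
  have hint : ∫ x, f x ∂mu b = 0 := by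
    have := integral_extremal_mul_char b α X T 0
    simp only [neg_zero, char_zero, mul_one, h0, if_false, ← hfc] at this
    rw [integral_complex_ofReal] at this
    exact_mod_cast this
  have hcub : cubature X f = D / N := by
    have h := sum_extremal b α X T
    simp only [← hfc] at h
    rw [← Complex.ofReal_sum] at h
    rw [cubature, Complex.ofReal_injective h, ← hD]
    ring
  have h := hX f hmem
  have hNpos : (0 : ℝ) < N := by exact_mod_cast hN
  rw [hint, hcub, hnorm, sub_zero, abs_of_nonneg (by positivity), div_le_iff₀ hNpos] at h
  have hs := Real.sq_sqrt hD0
  have hs0 := Real.sqrt_nonneg D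
  rcases hs0.eq_or_lt with h1 | h1
  · rw [← h1] at hs
    nlinarith [sq_nonneg (N * ε)]
  · have h2 : Real.sqrt D ≤ N * ε := by
      refine le_of_mul_le_mul_right ?_ h1
      nlinarith
    rw [← hs]
    exact pow_le_pow_left₀ hs0 h2 2

lemma sum_expSum_le (b : Module.Basis (Fin d) ℝ (E d)) (α : ℝ) {N : ℕ} (hN : 1 ≤ N)
    (X : Fin N → E d) {ε : ℝ}
    (hX : ∀ f : E d → ℝ, MemSobolev b α f →
      |cubature X f - ∫ x, f x ∂(mu b)| ≤ ε * sobolevNorm b α f)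
    (T : Finset (Fin d → ℤ)) (h0 : 0 ∉ T) :
    ∑ n ∈ T, (sobolevWeight b α n)⁻¹ * ‖expSum b X n‖ ^ 2 ≤ (N * ε) ^ 2 := by
  classical
  -- adding the negatives of the frequencies makes the set symmetric and only increases the sum
  refine le_trans (Finset.sum_le_sum_of_subset_of_nonneg
    (Finset.subset_union_left (s₂ := T.image Neg.neg)) fun n _ _ =>
    mul_nonneg (inv_nonneg.2 (sobolevWeight_pos b α n).le) (sq_nonneg _))
    (sum_expSum_le_of_symmetric b α hN X hX ?_ ?_)
  · intro n hn
    simp only [Finset.mem_union, Finset.mem_image] at hn ⊢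
    rcases hn with hn | ⟨m, hm, rfl⟩
    · exact Or.inr ⟨n, hn, rfl⟩
    · exact Or.inl (by rwa [neg_neg])
  · simp only [Finset.mem_union, Finset.mem_image, neg_eq_zero, exists_eq_right, or_self]
    exact h0

/-! ### Exponential sums over translated boxes -/

/-- The sum of `‖S(p - q + a)‖²` over `p, q ∈ Q` is a combination with unimodular coefficients
`char a (X j) * conj (char a (X l))` of nonnegative numbers that do not depend on `a`. -/
lemma sum_norm_sq_expSum_shift (b : Module.Basis (Fin d) ℝ (E d)) {N : ℕ} (X : Fin N → E d)
    (Q : Finset (Fin d → ℤ)) (a : Fin d → ℤ) :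
    ((∑ q ∈ Q, ∑ p ∈ Q, ‖expSum b X (p - q + a)‖ ^ 2 : ℝ) : ℂ)
      = ∑ j, ∑ l, char b a (X j) * (starRingEnd ℂ) (char b a (X l))
        * ((‖∑ p ∈ Q, char b p (X j) * (starRingEnd ℂ) (char b p (X l))‖ ^ 2 : ℝ) : ℂ) := by
  have h1 : ∀ n : Fin d → ℤ, ((‖expSum b X n‖ ^ 2 : ℝ) : ℂ)
      = ∑ j, ∑ l, char b n (X j) * (starRingEnd ℂ) (char b n (X l)) := by
    intro n
    rw [Complex.ofReal_pow, ← Complex.mul_conj', expSum, map_sum, Finset.sum_mul_sum]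
  have h2 : ∀ j l, ((‖∑ p ∈ Q, char b p (X j) * (starRingEnd ℂ) (char b p (X l))‖ ^ 2 : ℝ) : ℂ)
      = ∑ q ∈ Q, ∑ p ∈ Q, (char b p (X j) * (starRingEnd ℂ) (char b p (X l)))
        * ((starRingEnd ℂ) (char b q (X j)) * char b q (X l)) := by
    intro j l
    rw [Complex.ofReal_pow, ← Complex.mul_conj', map_sum, Finset.sum_mul_sum, Finset.sum_comm]
    simp only [map_mul, Complex.conj_conj]
  simp only [h2, Complex.ofReal_sum, h1]
  have h3 : ∀ q p, ∀ j l, char b (p - q + a) (X j) * (starRingEnd ℂ) (char b (p - q + a) (X l))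
      = char b a (X j) * (starRingEnd ℂ) (char b a (X l)) *
        ((char b p (X j) * (starRingEnd ℂ) (char b p (X l)))
        * ((starRingEnd ℂ) (char b q (X j)) * char b q (X l))) := by
    intro q p j l
    simp only [sub_eq_add_neg, char_add, char_neg, map_mul, Complex.conj_conj]
    ring
  simp only [h3, Finset.mul_sum]
  rw [Finset.sum_congr rfl fun q _ => Finset.sum_comm, Finset.sum_comm]
  refine Finset.sum_congr rfl fun j _ => ?_
  rw [Finset.sum_congr rfl fun q _ => Finset.sum_comm, Finset.sum_comm]

/-- Averages of the squared exponential sum over differences of a finite set are maximal at the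
origin, because the corresponding kernel is positive definite. -/
lemma sum_norm_sq_expSum_shift_le (b : Module.Basis (Fin d) ℝ (E d)) {N : ℕ} (X : Fin N → E d)
    (Q : Finset (Fin d → ℤ)) (a : Fin d → ℤ) :
    ∑ q ∈ Q, ∑ p ∈ Q, ‖expSum b X (p - q + a)‖ ^ 2
      ≤ ∑ q ∈ Q, ∑ p ∈ Q, ‖expSum b X (p - q)‖ ^ 2 := by
  have h0 := sum_norm_sq_expSum_shift b X Q 0
  simp only [add_zero, char_zero, map_one, one_mul, ← Complex.ofReal_sum] at h0
  rw [Complex.ofReal_injective h0]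
  have hnn : 0 ≤ ∑ q ∈ Q, ∑ p ∈ Q, ‖expSum b X (p - q + a)‖ ^ 2 := by positivity
  have h1 := congrArg norm (sum_norm_sq_expSum_shift b X Q a)
  rw [Complex.norm_real, Real.norm_of_nonneg hnn] at h1
  rw [h1]
  refine (norm_sum_le _ _).trans (Finset.sum_le_sum fun j _ => ?_)
  refine (norm_sum_le _ _).trans (Finset.sum_le_sum fun l _ => ?_)
  rw [norm_mul, norm_mul, RCLike.norm_conj, norm_char, norm_char, one_mul, one_mul,
    Complex.norm_real, Real.norm_of_nonneg (by positivity)]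

/-- The integer points of the cube `[0, m) ^ d`. -/
def box (d m : ℕ) : Finset (Fin d → ℤ) := Fintype.piFinset fun _ => Finset.Ico 0 (m : ℤ)

/-- The integer points of the cube `(-m, m) ^ d`. -/
def cube (d m : ℕ) : Finset (Fin d → ℤ) := Fintype.piFinset fun _ => Finset.Ioo (-m : ℤ) m

lemma mem_box {m : ℕ} {n : Fin d → ℤ} : n ∈ box d m ↔ ∀ i, 0 ≤ n i ∧ n i < m := by
  simp [box]

lemma mem_cube {m : ℕ} {n : Fin d → ℤ} : n ∈ cube d m ↔ ∀ i, -(m : ℤ) < n i ∧ n i < m := by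
  simp [cube]

lemma card_box (d m : ℕ) : (box d m).card = m ^ d := by simp [box]

/-- The mean square of the exponential sum over an arbitrary translate of a box is controlled by
the frequencies near the origin. -/
lemma sum_box_norm_sq_expSum_le (b : Module.Basis (Fin d) ℝ (E d)) {N : ℕ} (X : Fin N → E d)
    {m : ℕ} (hm : 1 ≤ m) (a : Fin d → ℤ) :
    ∑ r ∈ box d m, ‖expSum b X (a + r)‖ ^ 2
      ≤ 2 ^ d * ∑ n ∈ cube d (2 * m), ‖expSum b X n‖ ^ 2 := by
  -- every `r ∈ box d m` is the difference `p - q` of elements of the doubled box in at least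
  -- `m ^ d` ways, one for each `q ∈ box d m`
  have hlow : (m : ℝ) ^ d * ∑ r ∈ box d m, ‖expSum b X (a + r)‖ ^ 2
      ≤ ∑ q ∈ box d (2 * m), ∑ p ∈ box d (2 * m), ‖expSum b X (p - q + a)‖ ^ 2 := by
    have hsub : box d m ⊆ box d (2 * m) := fun q hq => by
      rw [mem_box] at hq ⊢
      intro i
      have := hq i
      push_cast; omega
    calc (m : ℝ) ^ d * ∑ r ∈ box d m, ‖expSum b X (a + r)‖ ^ 2
        = ∑ q ∈ box d m, ∑ r ∈ box d m, ‖expSum b X (a + r)‖ ^ 2 := by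
          rw [Finset.sum_const, card_box, nsmul_eq_mul]; push_cast; rfl
      _ ≤ ∑ q ∈ box d m, ∑ p ∈ box d (2 * m), ‖expSum b X (p - q + a)‖ ^ 2 := by
          refine Finset.sum_le_sum fun q hq => ?_
          have e : ∑ r ∈ box d m, ‖expSum b X (a + r)‖ ^ 2
              = ∑ p ∈ (box d m).map (addRightEmbedding q), ‖expSum b X (p - q + a)‖ ^ 2 := by
            rw [Finset.sum_map]
            refine Finset.sum_congr rfl fun r _ => ?_
            rw [addRightEmbedding_apply, add_sub_cancel_right, add_comm]
          rw [e]
          refine Finset.sum_le_sum_of_subset_of_nonneg (fun p hp => ?_) fun _ _ _ => by positivity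
          obtain ⟨r, hr, rfl⟩ := Finset.mem_map.1 hp
          rw [mem_box] at hq hr ⊢
          intro i
          have h1 := hq i
          have h2 := hr i
          simp only [addRightEmbedding_apply, Pi.add_apply]
          push_cast; omega
      _ ≤ _ := Finset.sum_le_sum_of_subset_of_nonneg hsub fun _ _ _ => by positivity
  -- for each `q` the differences `p - q` are distinct elements of the cube
  have hup : ∑ q ∈ box d (2 * m), ∑ p ∈ box d (2 * m), ‖expSum b X (p - q)‖ ^ 2
      ≤ (2 * m : ℝ) ^ d * ∑ n ∈ cube d (2 * m), ‖expSum b X n‖ ^ 2 := by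
    calc _ ≤ ∑ q ∈ box d (2 * m), ∑ n ∈ cube d (2 * m), ‖expSum b X n‖ ^ 2 := by
          refine Finset.sum_le_sum fun q hq => ?_
          have e : ∑ p ∈ box d (2 * m), ‖expSum b X (p - q)‖ ^ 2
              = ∑ n ∈ (box d (2 * m)).map (addRightEmbedding (-q)), ‖expSum b X n‖ ^ 2 := by
            rw [Finset.sum_map]
            simp only [addRightEmbedding_apply, sub_eq_add_neg]
          rw [e]
          refine Finset.sum_le_sum_of_subset_of_nonneg (fun p hp => ?_) fun _ _ _ => by positivity
          obtain ⟨r, hr, rfl⟩ := Finset.mem_map.1 hp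
          rw [mem_box] at hq hr
          rw [mem_cube]
          intro i
          have h1 := hq i
          have h2 := hr i
          simp only [addRightEmbedding_apply, Pi.add_apply, Pi.neg_apply]
          omega
      _ = _ := by rw [Finset.sum_const, card_box, nsmul_eq_mul]; push_cast; rfl
  have hmpos : (0 : ℝ) < (m : ℝ) ^ d := by positivity
  have h := (hlow.trans (sum_norm_sq_expSum_shift_le b X (box d (2 * m)) a)).trans hup
  rw [mul_pow, mul_comm ((2 : ℝ) ^ d), mul_assoc] at h
  exact le_of_mul_le_mul_left h hmpos

/-- The exponent `d + 1` exceeds the rank, so the corresponding lattice sum converges. -/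
lemma summable_norm_pow_inv_int (d : ℕ) : Summable fun n : Fin d → ℤ => (‖n‖ ^ (d + 1))⁻¹ := by
  set B := Pi.basisFun ℝ (Fin d)
  set L := Submodule.span ℤ (Set.range B)
  have hr : Module.finrank ℤ L < d + 1 := by
    rw [ZLattice.rank ℝ L]; simp
  have hs := ZLattice.summable_norm_pow_inv (L := L) (d + 1) hr
  have hmem : ∀ n : Fin d → ℤ, (fun i => (n i : ℝ)) ∈ L := fun n =>
    (B.mem_span_iff_repr_mem ℤ _).2 fun i => ⟨n i, by simp [B]⟩
  have hinj : Function.Injective fun n : Fin d → ℤ => (⟨fun i => (n i : ℝ), hmem n⟩ : L) := by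
    intro m n h
    funext i
    have : (m i : ℝ) = n i := congrFun (congrArg Subtype.val h) i
    exact_mod_cast this
  refine (hs.comp_injective hinj).congr fun n => ?_
  have : ‖(⟨fun i => (n i : ℝ), hmem n⟩ : L)‖ = ‖n‖ := by
    simp only [Submodule.coe_norm, Pi.norm_def]
    rfl
  simp only [Function.comp, this, inv_pow]

/-! ### Passing to the exponent `d + 1` -/

lemma one_le_norm_int {n : Fin d → ℤ} (hn : n ≠ 0) : 1 ≤ ‖n‖ := by
  obtain ⟨i, hi⟩ := Function.ne_iff.1 hn
  refine le_trans ?_ (norm_le_pi_norm n i)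
  rw [Int.norm_eq_abs]
  exact_mod_cast Int.one_le_abs hi

lemma norm_le_of_mem_cube {m : ℕ} {n : Fin d → ℤ} (hn : n ∈ cube d m) : ‖n‖ ≤ m := by
  refine (pi_norm_le_iff_of_nonneg (Nat.cast_nonneg m)).2 fun i => ?_
  have h := mem_cube.1 hn i
  rw [Int.norm_eq_abs]
  exact_mod_cast abs_le.2 ⟨h.1.le, h.2.le⟩

/-- The index of the translate of `box d m` containing `n`, in the tiling by `m • k + box d m`. -/
def boxIndex (m : ℕ) (n : Fin d → ℤ) : Fin d → ℤ := fun i => n i / m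

lemma exists_mem_box {m : ℕ} (hm : 1 ≤ m) (n : Fin d → ℤ) :
    n - (m : ℤ) • boxIndex m n ∈ box d m := by
  rw [mem_box]
  intro i
  have hm' : (0 : ℤ) < m := by exact_mod_cast hm
  have h1 := Int.emod_nonneg (n i) hm'.ne'
  have h2 := Int.emod_lt_of_pos (n i) hm'
  have h3 := Int.mul_ediv_add_emod (n i) m
  simp only [Pi.sub_apply, Pi.smul_apply, boxIndex, smul_eq_mul]
  constructor <;> linarith

/-- Outside of the cube of side `2 m` the index of the box is comparable with the frequency. -/
lemma boxIndex_of_notMem_cube {m : ℕ} (hm : 1 ≤ m) {n : Fin d → ℤ} (hn : n ∉ cube d (2 * m)) :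
    boxIndex m n ≠ 0 ∧ m * ‖boxIndex m n‖ ≤ 2 * ‖n‖ := by
  have hm' : (0 : ℤ) < m := by exact_mod_cast hm
  have hbox := mem_box.1 (exists_mem_box hm n)
  simp only [Pi.sub_apply, Pi.smul_apply, smul_eq_mul] at hbox
  simp only [mem_cube, not_forall] at hn
  obtain ⟨i, hi⟩ := hn
  push_cast at hi
  have hlarge : (m : ℝ) ≤ ‖n‖ := by
    refine le_trans ?_ (norm_le_pi_norm n i)
    rw [Int.norm_eq_abs]
    have : (m : ℤ) ≤ |n i| := by
      rw [le_abs]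
      by_contra hc
      omega
    exact_mod_cast this
  constructor
  · intro h0
    have h1 := hbox i
    rw [h0, Pi.zero_apply, mul_zero, sub_zero] at h1
    omega
  · have hmr : (0 : ℝ) < m := by exact_mod_cast hm
    rw [← le_div_iff₀' hmr]
    refine (pi_norm_le_iff_of_nonneg (by positivity)).2 fun j => ?_
    rw [le_div_iff₀' hmr, Int.norm_eq_abs]
    have h1 := hbox j
    have h2 : |(m : ℤ) * boxIndex m n j| ≤ |n j| + m := by
      have e : (m : ℤ) * boxIndex m n j = n j - (n j - m * boxIndex m n j) := by ring
      rw [e]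
      refine (abs_sub _ _).trans ?_
      rw [abs_of_nonneg h1.1]
      linarith
    have h3 : (m : ℝ) * |(boxIndex m n j : ℝ)| ≤ |(n j : ℝ)| + m := by
      have : ((|(m : ℤ) * boxIndex m n j| : ℤ) : ℝ) ≤ ((|n j| + m : ℤ) : ℝ) := by exact_mod_cast h2
      push_cast [abs_mul] at this
      rwa [abs_of_nonneg hmr.le] at this
    have h4 : |(n j : ℝ)| ≤ ‖n‖ := by
      have := norm_le_pi_norm n j
      rwa [Int.norm_eq_abs] at this
    linarith

/-- A weighted sum at the exponent `d + 1` over frequencies outside of the cube of side `2 m`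
is controlled by the largest sum over a box of side `m`. -/
lemma sum_notMem_cube_le {m : ℕ} (hm : 1 ≤ m) {s : (Fin d → ℤ) → ℝ} (hs : ∀ n, 0 ≤ s n) {B : ℝ}
    (hB : ∀ a, ∑ r ∈ box d m, s (a + r) ≤ B) {T : Finset (Fin d → ℤ)}
    (hT : ∀ n ∈ T, n ∉ cube d (2 * m)) :
    ∑ n ∈ T, (‖n‖ ^ (d + 1))⁻¹ * s n
      ≤ (2 / (m : ℝ)) ^ (d + 1) * B * ∑' k : Fin d → ℤ, (‖k‖ ^ (d + 1))⁻¹ := by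
  classical
  have hmr : (0 : ℝ) < m := by exact_mod_cast hm
  have hB0 : 0 ≤ B := (Finset.sum_nonneg fun r _ => hs _).trans (hB 0)
  rw [← Finset.sum_fiberwise_of_maps_to (t := T.image (boxIndex m))
    (g := boxIndex m) fun n hn => Finset.mem_image_of_mem _ hn]
  calc _ ≤ ∑ k ∈ T.image (boxIndex m), (2 / (m : ℝ)) ^ (d + 1) * B * (‖k‖ ^ (d + 1))⁻¹ := by
        refine Finset.sum_le_sum fun k hk => ?_
        obtain ⟨n₀, hn₀, rfl⟩ := Finset.mem_image.1 hk
        set k := boxIndex m n₀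
        have hk1 := one_le_norm_int (boxIndex_of_notMem_cube hm (hT n₀ hn₀)).1
        have hk0 : 0 < ‖k‖ := by linarith
        calc _ ≤ ∑ n ∈ T with boxIndex m n = k,
                (2 / (m : ℝ)) ^ (d + 1) * (‖k‖ ^ (d + 1))⁻¹ * s n := by
              refine Finset.sum_le_sum fun n hn => ?_
              obtain ⟨hnT, hnk⟩ := Finset.mem_filter.1 hn
              have h := (boxIndex_of_notMem_cube hm (hT n hnT)).2
              rw [hnk] at h
              refine mul_le_mul_of_nonneg_right ?_ (hs n)
              rw [← inv_pow, ← inv_pow, ← mul_pow]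
              refine pow_le_pow_left₀ (by positivity) ?_ _
              have hmk : 0 < m * ‖k‖ := by positivity
              have e : 2 / (m : ℝ) * ‖k‖⁻¹ = 2 / (m * ‖k‖) := by field_simp
              rw [e, inv_eq_one_div, div_le_div_iff₀ (by linarith) hmk]
              linarith
          _ = (2 / (m : ℝ)) ^ (d + 1) * (‖k‖ ^ (d + 1))⁻¹
                * ∑ n ∈ T with boxIndex m n = k, s n := by rw [Finset.mul_sum]
          _ ≤ (2 / (m : ℝ)) ^ (d + 1) * (‖k‖ ^ (d + 1))⁻¹ * B := by
              refine mul_le_mul_of_nonneg_left (le_trans ?_ (hB ((m : ℤ) • k))) (by positivity)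
              have e : ∑ r ∈ box d m, s ((m : ℤ) • k + r)
                  = ∑ n ∈ (box d m).map (addLeftEmbedding ((m : ℤ) • k)), s n := by
                rw [Finset.sum_map]; rfl
              rw [e]
              refine Finset.sum_le_sum_of_subset_of_nonneg (fun n hn => ?_) fun n _ _ => hs n
              obtain ⟨hnT, hnk⟩ := Finset.mem_filter.1 hn
              refine Finset.mem_map.2 ⟨n - (m : ℤ) • k, hnk ▸ exists_mem_box hm n, ?_⟩
              simp
          _ = _ := by ring
    _ = (2 / (m : ℝ)) ^ (d + 1) * B * ∑ k ∈ T.image (boxIndex m), (‖k‖ ^ (d + 1))⁻¹ := by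
        rw [Finset.mul_sum]
    _ ≤ _ := by
        gcongr
        exact (summable_norm_pow_inv_int d).sum_le_tsum _ fun k _ => by positivity

/-- A bound for the sums with weights `‖n‖ ^ (-2 α)` at the scale `x` implies the analogous bound
for the smaller exponent `d + 1 < 2 α`, provided that the sums over boxes of side `m ~ x` are
controlled by the one around the origin. The frequencies of size `O(x)` are treated by comparing
the weights, the others by summing the box bound over a tiling. -/
lemma exists_sum_norm_pow_inv_le (d : ℕ) {α : ℝ} (hα : ((d : ℝ) + 1) / 2 < α) {K : ℝ}
    (hK : 0 ≤ K) :
    ∃ K' : ℝ, 0 ≤ K' ∧ ∀ (x : ℝ) (m : ℕ) (s : (Fin d → ℤ) → ℝ), 1 ≤ x → x ≤ m → (m : ℝ) ≤ 2 * x →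
      (∀ n, 0 ≤ s n) → s 0 ≤ x ^ (2 * (d : ℝ)) →
      (∀ T : Finset (Fin d → ℤ), 0 ∉ T →
        ∑ n ∈ T, ‖n‖ ^ (-(2 * α)) * s n ≤ K * x ^ (2 * (d : ℝ) - 2 * α)) →
      (∀ a, ∑ r ∈ box d m, s (a + r) ≤ 2 ^ d * ∑ n ∈ cube d (2 * m), s n) →
      ∀ T : Finset (Fin d → ℤ), 0 ∉ T →
        ∑ n ∈ T, (‖n‖ ^ (d + 1))⁻¹ * s n ≤ K' * x ^ ((d : ℝ) - 1) := by
  classical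
  set Z := ∑' k : Fin d → ℤ, (‖k‖ ^ (d + 1))⁻¹ with hZ
  have hZ0 : 0 ≤ Z := tsum_nonneg fun k => by positivity
  set K₂ := 1 + (4 : ℝ) ^ (2 * α) * K with hK₂
  have hK₂0 : 0 ≤ K₂ := by positivity
  refine ⟨(4 : ℝ) ^ (2 * α - (d + 1)) * K + 2 ^ (d + 1) * (2 ^ d * K₂) * Z, by positivity, ?_⟩
  intro x m s hx hxm hmx hs hs0 hsum hbox T hT
  have hx0 : 0 < x := by linarith
  have hm : 1 ≤ m := by exact_mod_cast hx.trans hxm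
  have hcube : ∀ n ∈ cube d (2 * m), ‖n‖ ≤ 4 * x := fun n hn => by
    have := norm_le_of_mem_cube hn
    push_cast at this
    linarith
  have hd0 : (0 : ℝ) ≤ d := Nat.cast_nonneg d
  -- the total mass of the frequencies of size `O(x)`
  have hlow : ∑ n ∈ cube d (2 * m), s n ≤ K₂ * x ^ (2 * (d : ℝ)) := by
    have h0mem : (0 : Fin d → ℤ) ∈ cube d (2 * m) := by
      rw [mem_cube]
      intro i
      simp only [Pi.zero_apply]
      push_cast; omega
    rw [← Finset.add_sum_erase _ _ h0mem]
    have h1 : ∑ n ∈ (cube d (2 * m)).erase 0, s n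
        ≤ (4 * x) ^ (2 * α) * ∑ n ∈ (cube d (2 * m)).erase 0, ‖n‖ ^ (-(2 * α)) * s n := by
      rw [Finset.mul_sum]
      refine Finset.sum_le_sum fun n hn => ?_
      obtain ⟨hn0, hn⟩ := Finset.mem_erase.1 hn
      have hn1 := one_le_norm_int hn0
      have hnpos : 0 < ‖n‖ := by linarith
      rw [← mul_assoc]
      refine le_mul_of_one_le_left (hs n) ?_
      rw [Real.rpow_neg hnpos.le, ← div_eq_mul_inv, one_le_div (by positivity)]
      exact Real.rpow_le_rpow hnpos.le (hcube n hn) (by linarith)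
    have h2 := hsum ((cube d (2 * m)).erase 0) (by simp)
    have h3 : (4 * x) ^ (2 * α) * (K * x ^ (2 * (d : ℝ) - 2 * α))
        = (4 : ℝ) ^ (2 * α) * K * x ^ (2 * (d : ℝ)) := by
      rw [Real.mul_rpow (by norm_num) hx0.le, Real.rpow_sub hx0]
      field_simp
    have h4 := mul_le_mul_of_nonneg_left h2 (show 0 ≤ (4 * x) ^ (2 * α) by positivity)
    rw [hK₂, add_mul, one_mul]
    linarith
  rw [← Finset.sum_filter_add_sum_filter_not T (· ∈ cube d (2 * m)), add_mul]
  refine add_le_add ?_ ?_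
  · have h1 : ∑ n ∈ T with n ∈ cube d (2 * m), (‖n‖ ^ (d + 1))⁻¹ * s n
        ≤ (4 * x) ^ (2 * α - (d + 1))
          * ∑ n ∈ T with n ∈ cube d (2 * m), ‖n‖ ^ (-(2 * α)) * s n := by
      rw [Finset.mul_sum]
      refine Finset.sum_le_sum fun n hn => ?_
      obtain ⟨hnT, hn⟩ := Finset.mem_filter.1 hn
      have hn1 := one_le_norm_int (fun h => hT (h ▸ hnT))
      have hnpos : 0 < ‖n‖ := by linarith
      rw [← mul_assoc]
      refine mul_le_mul_of_nonneg_right ?_ (hs n)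
      have e : (‖n‖ ^ (d + 1))⁻¹ = ‖n‖ ^ (2 * α - (d + 1)) * ‖n‖ ^ (-(2 * α)) := by
        rw [← Real.rpow_add hnpos, ← Real.rpow_natCast, ← Real.rpow_neg hnpos.le]
        congr 1
        push_cast; ring
      rw [e]
      gcongr
      · linarith
      · exact hcube n hn
    refine h1.trans ?_
    have h2 := hsum (T.filter (· ∈ cube d (2 * m))) (fun h => hT (Finset.mem_filter.1 h).1)
    refine (mul_le_mul_of_nonneg_left h2 (by positivity)).trans (le_of_eq ?_)
    rw [Real.mul_rpow (by norm_num) hx0.le]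
    have e : x ^ ((d : ℝ) - 1) = x ^ (2 * α - (d + 1)) * x ^ (2 * (d : ℝ) - 2 * α) := by
      rw [← Real.rpow_add hx0]; congr 1; ring
    rw [e]; ring
  · have h1 := sum_notMem_cube_le hm hs (B := 2 ^ d * (K₂ * x ^ (2 * (d : ℝ))))
      (fun a => (hbox a).trans (by gcongr)) (T := T.filter (· ∉ cube d (2 * m)))
      (fun n hn => (Finset.mem_filter.1 hn).2)
    refine h1.trans ?_
    have h2 : (2 / (m : ℝ)) ^ (d + 1) ≤ (2 / x) ^ (d + 1) := by gcongr
    have e : x ^ ((d : ℝ) - 1) = x ^ (2 * (d : ℝ)) / x ^ (d + 1) := by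
      rw [← Real.rpow_natCast, ← Real.rpow_sub hx0]
      congr 1
      push_cast; ring
    calc _ ≤ (2 / x) ^ (d + 1) * (2 ^ d * (K₂ * x ^ (2 * (d : ℝ)))) * Z := by gcongr
      _ = _ := by rw [e, div_pow]; ring

/-! ### Bounds for the number variance -/

lemma numberVariance_nonneg (b : Module.Basis (Fin d) ℝ (E d)) {N : ℕ} (X : Fin N → E d) (R : ℝ) :
    0 ≤ numberVariance b X R :=
  integral_nonneg fun _ => sq_nonneg _

/-- The number variance is dominated by the weighted sum of the squared exponential sums with
exponent `d + 1`, by the Fourier expansion and the decay of the Fourier transform of the ball. -/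
lemma exists_numberVariance_le_of_sum_le (hd : 1 ≤ d) (b : Module.Basis (Fin d) ℝ (E d)) :
    ∃ C : ℝ, 0 ≤ C ∧ ∀ (N : ℕ) (X : Fin N → E d) (R M : ℝ), 0 < R →
      (∀ T : Finset (Fin d → ℤ), 0 ∉ T →
        ∑ n ∈ T, (‖n‖ ^ (d + 1))⁻¹ * ‖expSum b X n‖ ^ 2 ≤ M) →
      numberVariance b X R ≤ C * R ^ (d - 1) * M := by
  classical
  obtain ⟨C, hC0, hC⟩ := exists_ballTransform_bound d hd
  obtain ⟨c, hc0, hc⟩ := exists_norm_le_norm_dualVec b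
  set v := (volume.real (cell b))⁻¹ ^ 2
  have hv : 0 ≤ v := sq_nonneg _
  refine ⟨v * (C / c ^ (d + 1)), by positivity, fun N X R M hR hM => ?_⟩
  refine hasSum_le_of_sum_le (hasSum_numberVariance b X R) fun T => ?_
  have hterm : ∀ n ∈ T.erase 0, (if n = 0 then 0 else
      ‖expSum b X n‖ ^ 2 * (v * ‖ballTransform d R (dualVec b n)‖ ^ 2))
      ≤ v * (C / c ^ (d + 1)) * R ^ (d - 1) * ((‖n‖ ^ (d + 1))⁻¹ * ‖expSum b X n‖ ^ 2) := by
    intro n hn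
    have hn0 := Finset.ne_of_mem_erase hn
    have hn1 := one_le_norm_int hn0
    have hnpos : 0 < ‖n‖ := by linarith
    have hcn : 0 < c * ‖n‖ := by positivity
    have hw : dualVec b n ≠ 0 := norm_pos_iff.1 (hcn.trans_le (hc n))
    rw [if_neg hn0]
    calc ‖expSum b X n‖ ^ 2 * (v * ‖ballTransform d R (dualVec b n)‖ ^ 2)
        ≤ ‖expSum b X n‖ ^ 2 * (v * (C * R ^ (d - 1) / (c * ‖n‖) ^ (d + 1))) := by
          gcongr
          refine (hC R hR _ hw).trans ?_
          gcongr
          exact hc n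
      _ = _ := by rw [mul_pow]; field_simp
  have hzero : ∑ n ∈ T, (if n = 0 then 0 else
      ‖expSum b X n‖ ^ 2 * (v * ‖ballTransform d R (dualVec b n)‖ ^ 2))
      = ∑ n ∈ T.erase 0, (if n = 0 then 0 else
      ‖expSum b X n‖ ^ 2 * (v * ‖ballTransform d R (dualVec b n)‖ ^ 2)) :=
    (Finset.sum_erase (f := fun n => if n = 0 then 0 else
      ‖expSum b X n‖ ^ 2 * (v * ‖ballTransform d R (dualVec b n)‖ ^ 2)) T (if_pos rfl)).symm
  rw [hzero]
  refine (Finset.sum_le_sum hterm).trans ?_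
  rw [← Finset.mul_sum]
  exact mul_le_mul_of_nonneg_left (hM _ (by simp)) (by positivity)

/-- The Sobolev weight is comparable with `‖n‖ ^ (2 α)`; only the upper bound is needed, since the
weight enters the QMC estimate through its inverse. -/
lemma exists_sobolevWeight_le (b : Module.Basis (Fin d) ℝ (E d)) {α : ℝ} (hα : 0 ≤ α) :
    ∃ C : ℝ, 0 < C ∧ ∀ n : Fin d → ℤ, n ≠ 0 → sobolevWeight b α n ≤ C * ‖n‖ ^ (2 * α) := by
  obtain ⟨c, hc0, hc⟩ := exists_norm_dualVec_le b
  refine ⟨(1 + 4 * Real.pi ^ 2 * c ^ 2) ^ α, by positivity, fun n hn => ?_⟩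
  have hn1 := one_le_norm_int hn
  have hn2 : 1 ≤ ‖n‖ ^ 2 := one_le_pow₀ hn1
  rw [Real.rpow_mul (norm_nonneg n), Real.rpow_two, ← Real.mul_rpow (by positivity) (by positivity)]
  refine Real.rpow_le_rpow (by positivity) ?_ hα
  have h : ‖dualVec b n‖ ^ 2 ≤ (c * ‖n‖) ^ 2 := pow_le_pow_left₀ (norm_nonneg _) (hc n) 2
  rw [mul_pow] at h
  have := mul_le_mul_of_nonneg_left h (show 0 ≤ 4 * Real.pi ^ 2 by positivity)
  linarith

/-- QMC designs have number variance `O((R N ^ (1 / d)) ^ (d - 1))`, uniformly in the radius. -/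
lemma exists_numberVariance_le (hd : 1 ≤ d) (b : Module.Basis (Fin d) ℝ (E d)) {A : Set ℕ}
    {X : (N : ℕ) → Fin N → E d} {α : ℝ} (hα : ((d : ℝ) + 1) / 2 < α)
    (hQMC : IsQMCDesign b A X α) :
    ∃ C : ℝ, 0 ≤ C ∧ ∀ N ∈ A, 1 ≤ N → ∀ R : ℝ, 0 < R →
      numberVariance b (X N) R ≤ C * (R * (N : ℝ) ^ (1 / (d : ℝ))) ^ ((d : ℝ) - 1) := by
  obtain ⟨c, hc0, hc⟩ := hQMC
  have hd0 : (0 : ℝ) < d := by exact_mod_cast hd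
  obtain ⟨W, hW0, hW⟩ := exists_sobolevWeight_le b (α := α) (by linarith)
  obtain ⟨K, hK0, hK⟩ := exists_sum_norm_pow_inv_le d hα (K := W * c ^ 2) (by positivity)
  obtain ⟨C, hC0, hC⟩ := exists_numberVariance_le_of_sum_le hd b
  refine ⟨C * K, by positivity, fun N hNA hN R hR => ?_⟩
  set x := (N : ℝ) ^ (1 / (d : ℝ)) with hx
  have hN1 : (1 : ℝ) ≤ N := by exact_mod_cast hN
  have hx1 : 1 ≤ x := Real.one_le_rpow hN1 (by positivity)
  have hx0 : 0 < x := by linarith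
  have hxN : ∀ r : ℝ, (N : ℝ) ^ r = x ^ (d * r) := by
    intro r
    rw [hx, ← Real.rpow_mul (by positivity)]
    congr 1
    field_simp
  have hceil := Nat.ceil_lt_add_one hx0.le
  have hm := Nat.le_ceil x
  have hm1 : 1 ≤ ⌈x⌉₊ := Nat.one_le_ceil_iff.2 hx0
  have hNx : (N : ℝ) = x ^ (d : ℝ) := by simpa using hxN 1
  have h := hK x ⌈x⌉₊ (fun n => ‖expSum b (X N) n‖ ^ 2) hx1 hm (by linarith)
    (fun n => sq_nonneg _) ?_ ?_ (sum_box_norm_sq_expSum_le b (X N) hm1)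
  · refine (hC N (X N) R _ hR h).trans (le_of_eq ?_)
    have e : R ^ (d - 1) = R ^ ((d : ℝ) - 1) := by
      rw [← Real.rpow_natCast, Nat.cast_sub hd, Nat.cast_one]
    rw [e, Real.mul_rpow hR.le hx0.le]
    ring
  · simp only [expSum, char_zero, Finset.sum_const, Finset.card_univ, Fintype.card_fin]
    rw [nsmul_eq_mul, mul_one, Complex.norm_natCast, hNx, ← Real.rpow_natCast,
      ← Real.rpow_mul hx0.le]
    refine le_of_eq ?_
    congr 1
    push_cast; ring
  · intro T hT
    have h1 := sum_expSum_le b α hN (X N) (hc N hNA hN) T hT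
    have h2 : ∀ n ∈ T, ‖n‖ ^ (-(2 * α)) * ‖expSum b (X N) n‖ ^ 2
        ≤ W * ((sobolevWeight b α n)⁻¹ * ‖expSum b (X N) n‖ ^ 2) := by
      intro n hn
      have hn0 : n ≠ 0 := fun h => hT (h ▸ hn)
      have hnpos : 0 < ‖n‖ := norm_pos_iff.2 hn0
      rw [← mul_assoc]
      refine mul_le_mul_of_nonneg_right ?_ (sq_nonneg _)
      rw [Real.rpow_neg hnpos.le, ← div_eq_mul_inv, le_div_iff₀ (sobolevWeight_pos b α n),
        inv_mul_le_iff₀ (by positivity), mul_comm]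
      exact hW n hn0
    refine (Finset.sum_le_sum h2).trans ?_
    rw [← Finset.mul_sum]
    refine (mul_le_mul_of_nonneg_left h1 hW0.le).trans (le_of_eq ?_)
    rw [hxN]
    nth_rewrite 1 [hNx]
    have e1 : (d : ℝ) * -(α / d) = -α := by field_simp
    have e2 : x ^ (2 * (d : ℝ) - 2 * α) = (x ^ (d : ℝ) * x ^ (-α)) ^ 2 := by
      rw [← Real.rpow_add hx0, ← Real.rpow_natCast, ← Real.rpow_mul hx0.le]
      congr 1
      push_cast; ring
    rw [e1, e2]
    ring

lemma isLittleO_of_le_mul {l : Filter ℕ} {f ε g : ℕ → ℝ} (hf : ∀ N, 0 ≤ f N)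
    (hε : Tendsto ε l (𝓝 0)) (hg : ∀ᶠ N in l, 0 ≤ g N) (h : ∀ᶠ N in l, f N ≤ ε N * g N) :
    f =o[l] g := by
  refine isLittleO_iff.2 fun c hc => ?_
  filter_upwards [hg, h, hε.eventually_le_const hc] with N h1 h2 h3
  rw [Real.norm_of_nonneg (hf N), Real.norm_of_nonneg h1]
  exact h2.trans (mul_le_mul_of_nonneg_right h3 h1)

lemma eventually_mem_toInfty (A : Set ℕ) : ∀ᶠ N in toInfty A, N ∈ A ∧ 1 ≤ N :=
  Filter.Eventually.and (mem_inf_of_right (mem_principal_self A))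
    (Filter.Eventually.filter_mono inf_le_left (eventually_ge_atTop 1))

lemma tendsto_rpow_toInfty (A : Set ℕ) {r : ℝ} (hr : 0 < r) :
    Tendsto (fun N : ℕ => (N : ℝ) ^ r) (toInfty A) atTop :=
  ((tendsto_rpow_atTop hr).comp tendsto_natCast_atTop_atTop).mono_left inf_le_left

lemma ballVol_eq (b : Module.Basis (Fin d) ℝ (E d)) {R : ℝ} (hR : 0 ≤ R) :
    ballVol b R = R ^ d * ballVol b 1 := by
  have h : volume.real (Metric.closedBall (0 : E d) R)
      = R ^ d * volume.real (Metric.closedBall (0 : E d) 1) := by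
    rw [Measure.real, Measure.addHaar_closedBall' _ _ hR, ENNReal.toReal_mul,
      ENNReal.toReal_ofReal (by positivity), finrank_euclideanSpace, Fintype.card_fin,
      Measure.real]
  rw [ballVol, ballVol, h, mul_div_assoc]

lemma ballVol_one_pos (b : Module.Basis (Fin d) ℝ (E d)) : 0 < ballVol b 1 := by
  refine div_pos ?_ ?_
  · exact ENNReal.toReal_pos (Metric.measure_closedBall_pos _ _ one_pos).ne'
      measure_closedBall_lt_top.ne
  · exact ENNReal.toReal_pos (volume_cell_ne_zero b) (volume_cell_ne_top b)

section Hyperuniformity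

variable {b : Module.Basis (Fin d) ℝ (E d)} {A : Set ℕ} {X : (N : ℕ) → Fin N → E d} {C : ℝ}

lemma hyperuniformLarge_of_bound (hd : 1 ≤ d)
    (hC : ∀ N ∈ A, 1 ≤ N → ∀ R : ℝ, 0 < R →
      numberVariance b (X N) R ≤ C * (R * (N : ℝ) ^ (1 / (d : ℝ))) ^ ((d : ℝ) - 1)) :
    HyperuniformLarge b A X := by
  intro R hR _
  have hd0 : (0 : ℝ) < d := by exact_mod_cast hd
  refine isLittleO_of_le_mul (ε := fun N => C * R ^ ((d : ℝ) - 1) * ((N : ℝ) ^ (1 / (d : ℝ)))⁻¹)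
    (fun N => numberVariance_nonneg b _ _) ?_ (Eventually.of_forall fun N => Nat.cast_nonneg N) ?_
  · rw [← mul_zero (C * R ^ ((d : ℝ) - 1))]
    exact ((tendsto_rpow_toInfty A (by positivity)).inv_tendsto_atTop).const_mul _
  · filter_upwards [eventually_mem_toInfty A] with N hN
    refine (hC N hN.1 hN.2 R hR).trans (le_of_eq ?_)
    have hNpos : (0 : ℝ) < N := by exact_mod_cast hN.2
    have e : ((N : ℝ) ^ (1 / (d : ℝ))) ^ ((d : ℝ) - 1) = ((N : ℝ) ^ (1 / (d : ℝ)))⁻¹ * N := by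
      rw [← Real.rpow_mul hNpos.le, ← Real.rpow_neg hNpos.le]
      nth_rewrite 3 [← Real.rpow_one (N : ℝ)]
      rw [← Real.rpow_add hNpos]
      congr 1
      field_simp
      ring
    rw [Real.mul_rpow hR.le (by positivity), e]
    ring

lemma hyperuniformSmall_of_bound (hd : 1 ≤ d)
    (hC : ∀ N ∈ A, 1 ≤ N → ∀ R : ℝ, 0 < R →
      numberVariance b (X N) R ≤ C * (R * (N : ℝ) ^ (1 / (d : ℝ))) ^ ((d : ℝ) - 1)) :
    HyperuniformSmall b A X := by
  intro R hR _ hlim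
  have hd0 : (0 : ℝ) < d := by exact_mod_cast hd
  set κ := ballVol b 1 with hκ
  have hκ0 : 0 < κ := ballVol_one_pos b
  set y : ℕ → ℝ := fun N => R N * (N : ℝ) ^ (1 / (d : ℝ)) with hy
  -- the normalizing quantity `N vol(R_N)` is a multiple of `y ^ d`
  have hvol : ∀ᶠ N in toInfty A, 0 < y N ∧ (N : ℝ) * ballVol b (R N) = κ * y N ^ (d : ℝ) := by
    filter_upwards [eventually_mem_toInfty A] with N hN
    have hRN := hR N hN.1
    have hNpos : (0 : ℝ) < N := by exact_mod_cast hN.2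
    refine ⟨by positivity, ?_⟩
    simp only [hy]
    rw [ballVol_eq b hRN.le, Real.mul_rpow hRN.le (by positivity), ← Real.rpow_mul hNpos.le,
      one_div_mul_cancel hd0.ne', Real.rpow_one, Real.rpow_natCast]
    ring
  have hyt : Tendsto y (toInfty A) atTop := by
    have h1 : Tendsto (fun N : ℕ => κ⁻¹ * ((N : ℝ) * ballVol b (R N))) (toInfty A) atTop :=
      hlim.const_mul_atTop (inv_pos.2 hκ0)
    refine ((tendsto_rpow_atTop (one_div_pos.2 hd0)).comp h1).congr' ?_
    filter_upwards [hvol] with N hN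
    simp only [Function.comp]
    rw [hN.2, inv_mul_cancel_left₀ hκ0.ne', ← Real.rpow_mul hN.1.le, mul_one_div_cancel hd0.ne',
      Real.rpow_one]
  refine isLittleO_of_le_mul (ε := fun N => C / κ * (y N)⁻¹)
    (fun N => numberVariance_nonneg b _ _) ?_ ?_ ?_
  · rw [← mul_zero (C / κ)]
    exact hyt.inv_tendsto_atTop.const_mul _
  · filter_upwards [hvol] with N hN
    rw [hN.2]
    have := hN.1
    positivity
  · filter_upwards [hvol, eventually_mem_toInfty A] with N hN hNA
    refine (hC N hNA.1 hNA.2 (R N) (hR N hNA.1)).trans (le_of_eq ?_)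
    rw [hN.2, Real.rpow_sub_one hN.1.ne']
    simp only [hy]
    field_simp

lemma hyperuniformThreshold_of_bound
    (hC : ∀ N ∈ A, 1 ≤ N → ∀ R : ℝ, 0 < R →
      numberVariance b (X N) R ≤ C * (R * (N : ℝ) ^ (1 / (d : ℝ))) ^ ((d : ℝ) - 1)) :
    HyperuniformThreshold b A X := by
  refine ⟨C, ?_⟩
  filter_upwards [eventually_gt_atTop 0] with t ht
  refine limsup_le_of_le (h := ?_)
  filter_upwards [eventually_mem_toInfty A] with N hN
  have hNpos : (0 : ℝ) < N := by exact_mod_cast hN.2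
  have h := hC N hN.1 hN.2 (t * (N : ℝ) ^ (-(1 / (d : ℝ)))) (by positivity)
  rw [mul_assoc, ← Real.rpow_add hNpos, neg_add_cancel, Real.rpow_zero, mul_one] at h
  exact EReal.coe_le_coe_iff.2 h

end Hyperuniformity

end FlatTorus

end

theorem theorem3p4 (d : ℕ) (hd : 1 ≤ d)
    (b : Module.Basis (Fin d) ℝ (EuclideanSpace ℝ (Fin d)))
    (A : Set ℕ) (hA : A.Infinite)
    (X : (N : ℕ) → Fin N → EuclideanSpace ℝ (Fin d))
    (hX : ∀ N ∈ A, ∀ j, X N j ∈ FlatTorus.cell b)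
    (α : ℝ) (hα : ((d : ℝ) + 1) / 2 < α)
    (hQMC : FlatTorus.IsQMCDesign b A X α) :
    FlatTorus.HyperuniformLarge b A X ∧
      FlatTorus.HyperuniformSmall b A X ∧
      FlatTorus.HyperuniformThreshold b A X := by
  obtain ⟨C, -, hC⟩ := FlatTorus.exists_numberVariance_le hd b hα hQMC
  exact ⟨FlatTorus.hyperuniformLarge_of_bound hd hC, FlatTorus.hyperuniformSmall_of_bound hd hC,
    FlatTorus.hyperuniformThreshold_of_bound hC⟩
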